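/- Let $X$ be a real Banach space with dual $X^*$ and bidual $X^{**}$, all with their norm topologies, let $X$ be identified with its canonical image in $X^{**}$, and let $\pi(x,x^*)=\langle x,x^*\rangle$ and $\pi_*(x^*,x^{**})=\langle x^*,x^{**}\rangle$ be the duality products on $X\times X^*$ and $X^*\times X^{**}$. A point-to-set operator $T:X\rightrightarrows X^*$ is identified with its graph $T\subset X\times X^*$; a maximal monotone operator $T$ is of type NI if $$\inf_{(y,y^*)\in T}\langle x^*-y^*,\,x^{**}-y\rangle\le 0\qquad\text{for all }(x^*,x^{**})\in X^*\times X^{**}.$$ The Fitzpatrick family $\mathcal F_T$ is the set of convex, lower semicontinuous $h:X\times X^*\to[-\infty,\infty]$ with $h\ge\pi$ everywhere and $h=\pi$ on $T$. For $h:X\times X^*\to[-\infty,\infty]$ put $$h^*(x^*,x^{**})=\sup_{(z,z^*)\in X\times X^*}\bigl(\langle z,x^*\rangle+\langle z^*,x^{**}\rangle-h(z,z^*)\bigr),\qquad \mathcal Jh(x,x^*)=h^*(x^*,x),$$ let $\operatorname{cl}h$ be the largest lower semicontinuous function majorized by $h$, and let $D_X(h)=\{x\in X : h(x,x^*)<\infty\text{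 for some }x^*\in X^*\}$. Let $T_1,T_2:X\rightrightarrows X^*$ be maximal monotone of type NI, let $h_1\in\mathcal F_{T_1}$, $h_2\in\mathcal F_{T_2}$, and define $$h(x,x^*)=\inf_{y^*\in X^*}\bigl(h_1(x,y^*)+h_2(x,x^*-y^*)\bigr),\qquad (x,x^*)\in X\times X^*.$$ Suppose that $\bigcup_{\lambda>0}\lambda\,(D_X(h_1)-D_X(h_2))$ is a closed subspace of $X$. Then $$h\ge\pi,\quad h^*\ge\pi_*,\quad \mathcal Jh\ge\pi,\quad (\mathcal Jh)^*\ge\pi_*,$$ $$T_1+T_2=\{(x,x^*) : \mathcal Jh(x,x^*)=\langle x,x^*\rangle\}=\{(x,x^*) : h(x,x^*)=\langle x,x^*\rangle\},$$ where $T_1+T_2=\{(x,u^*+v^*) : (x,u^*)\in T_1,\ (x,v^*)\in T_2\}$; the operator $T_1+T_2$ is maximal monotone of type NI, and $\mathcal Jh\in\mathcal F_{T_1+T_2}$, $\operatorname{cl}h\in\mathcal F_{T_1+T_2}$. -/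

import Mathlib

open scoped Pointwise

namespace MonotoneNI

noncomputable section

/-! Point to set operators `T : X ⇉ X*` are identified with their graphs in `X × X*`.
The dual `X*` carries its norm topology throughout. -/

/-- The duality product `π` on `X × X*`. -/
def pairing {X : Type*} [NormedAddCommGroup X] [NormedSpace ℝ X]
    (p : X × StrongDual ℝ X) : ℝ :=
  p.2 p.1

/-- Monotone operators. -/
def IsMonotoneOp {X : Type*} [NormedAddCommGroup X] [NormedSpace ℝ X]
    (T : Set (X × StrongDual ℝ X)) : Prop :=
  ∀ p ∈ T, ∀ q ∈ T, 0 ≤ (p.2 - q.2) (p.1 - q.1)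

/-- Maximal monotone operators: maximal, for inclusion of graphs, among the monotone ones. -/
def IsMaximalMonotoneOp {X : Type*} [NormedAddCommGroup X] [NormedSpace ℝ X]
    (T : Set (X × StrongDual ℝ X)) : Prop :=
  Maximal IsMonotoneOp T

/-- The condition NI: `inf_{(y, y*) ∈ T} ⟨x* - y*, x** - y⟩ ≤ 0` for all
`(x*, x**) ∈ X* × X**`, where `y` is seen in `X**` through the canonical injection. -/
def IsTypeNI {X : Type*} [NormedAddCommGroup X] [NormedSpace ℝ X]
    (T : Set (X × StrongDual ℝ X)) : Prop :=
  ∀ (xs : StrongDual ℝ X) (xss : StrongDual ℝ (StrongDual ℝ X)),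
    (⨅ q ∈ T, (((xss - NormedSpace.inclusionInDoubleDual ℝ X q.1) (xs - q.2) : ℝ) : EReal)) ≤ 0

/-- Pointwise sum of operators: `(T₁ + T₂)(x) = T₁(x) + T₂(x)`. -/
def opSum {X : Type*} [NormedAddCommGroup X] [NormedSpace ℝ X]
    (T₁ T₂ : Set (X × StrongDual ℝ X)) : Set (X × StrongDual ℝ X) :=
  {p | ∃ u v : StrongDual ℝ X, (p.1, u) ∈ T₁ ∧ (p.1, v) ∈ T₂ ∧ p.2 = u + v}

/-- Convexity of an extended real valued function: its epigraph is convex. -/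
def IsConvexFun {E : Type*} [AddCommGroup E] [Module ℝ E] (f : E → EReal) : Prop :=
  Convex ℝ {p : E × ℝ | f p.1 ≤ (p.2 : EReal)}

/-- The lower semicontinuous closure `cl f`: the largest lower semicontinuous function
majorized by `f`. -/
def lscClosure {E : Type*} [TopologicalSpace E] (f : E → EReal) : E → EReal :=
  fun x => ⨆ g ∈ {g : E → EReal | LowerSemicontinuous g ∧ ∀ y, g y ≤ f y}, g x

/-- The Fenchel conjugate `f*` of `f : E → [-∞, ∞]`. -/
def conjugate {E : Type*} [NormedAddCommGroup E] [NormedSpace ℝ E] (f : E → EReal) :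
    StrongDual ℝ E → EReal :=
  fun φ => ⨆ x : E, ((φ x : ℝ) : EReal) - f x

/-- The conjugate of `h : X × X* → [-∞, ∞]`, as a function on `X* × X** = (X × X*)*`, a pair
`(x*, x**)` acting by `(z, z*) ↦ ⟨z, x*⟩ + ⟨z*, x**⟩`. -/
def pairConjugate {X : Type*} [NormedAddCommGroup X] [NormedSpace ℝ X]
    (h : X × StrongDual ℝ X → EReal) :
    StrongDual ℝ X × StrongDual ℝ (StrongDual ℝ X) → EReal :=
  fun q => conjugate h (q.1.coprod q.2)

/-- `𝒥 h (x, x*) = h*(x*, x)`. -/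
def transposeConj {X : Type*} [NormedAddCommGroup X] [NormedSpace ℝ X]
    (h : X × StrongDual ℝ X → EReal) : X × StrongDual ℝ X → EReal :=
  fun p => pairConjugate h (p.2, NormedSpace.inclusionInDoubleDual ℝ X p.1)

/-- The Fitzpatrick family `ℱ_T`. -/
def fitzpatrickFamily {X : Type*} [NormedAddCommGroup X] [NormedSpace ℝ X]
    (T : Set (X × StrongDual ℝ X)) : Set (X × StrongDual ℝ X → EReal) :=
  {h | IsConvexFun h ∧ LowerSemicontinuous h ∧
    (∀ p, (pairing p : EReal) ≤ h p) ∧ ∀ p ∈ T, h p = (pairing p : EReal)}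

/-- The inf-convolution of `h₁` and `h₂` in the dual variable. -/
def partialInfConv {X : Type*} [NormedAddCommGroup X] [NormedSpace ℝ X]
    (h₁ h₂ : X × StrongDual ℝ X → EReal) : X × StrongDual ℝ X → EReal :=
  fun p => ⨅ y : StrongDual ℝ X, h₁ (p.1, y) + h₂ (p.1, p.2 - y)

/-- `D_X(h)`, the projection on `X` of the effective domain of `h`. -/
def domX {X : Type*} [NormedAddCommGroup X] [NormedSpace ℝ X]
    (h : X × StrongDual ℝ X → EReal) : Set X :=
  {x | ∃ xs : StrongDual ℝ X, h (x, xs) < ⊤}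

end

end MonotoneNI

open MonotoneNI

/-! Everything rests on the contact sets `{H = π}` of convex lower semicontinuous functions with `H
≥ π` and `H* ≥ π_*`: they are maximal monotone (`isMaximalMonotoneOp_contact`) and of type NI
(`isTypeNI_contact`). Indeed, `H` minus the affine part at `w`, plus a quadratic weight dominating
`|π|`, has infimum at most zero by Fenchel duality (`exists_weight_lt`). An almost minimizer has a
small gap `H - π` and lies close to an exact contact point (`exists_contact_near`), so the contact
set nearly solves the translated inequality at every `w`.

Conversely, NI gives `h_i* ≥ π_*`, and convexity makes `𝒥 h_i` touch `π` exactly on `T_i`. The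
closed subspace condition allows an exact splitting (`exists_pairConjugate_split`): for some `u`,
`h*(x*, x**)` is at least `h₁*(u, x**) + h₂*(x* - u, x**)`, hence at least `⟨x*, x**⟩`. As `h` need
not be lower semicontinuous, the contact theorem is applied to `cl h`, which has the same conjugate.
Its contact set `T` is also that of `𝒥 h`, and splitting `𝒥 h = π` yields equality in both `𝒥 h_i ≥
π`, so `T₁ + T₂ ⊆ {h = π} ⊆ {cl h = π} = {𝒥 h = π} ⊆ T₁ + T₂`. -/

namespace MonotoneNI

open Filter Topology

/-! ### Open mapping and Lagrange multipliers for closed convex sets -/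

section ConvexOpenMapping

variable {E F : Type*} [NormedAddCommGroup E] [NormedSpace ℝ E] [CompleteSpace E]
  [NormedAddCommGroup F] [NormedSpace ℝ F]

/-- If the image of a bounded closed convex set is dense in a ball, it contains the half ball. -/
theorem ball_half_subset_image_of_subset_closure_image {K : Set E} (hK : Convex ℝ K)
    (hKc : IsClosed K) {R : ℝ} (hR : ∀ e ∈ K, ‖e‖ ≤ R) (A : E →L[ℝ] F) {r : ℝ}
    (hball : ∀ v : F, ‖v‖ < r → v ∈ closure (A '' K)) (d : F) (hd : ‖d‖ < r / 2) :
    d ∈ A '' K := by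
  have hr : 0 < r := by linarith [norm_nonneg d]
  have step : ∀ v : {v : F // ‖v‖ < r}, ∃ e ∈ K, ‖(2 : ℝ) • (v.1 - A e)‖ < r := by
    rintro ⟨v, hv⟩
    obtain ⟨_, ⟨e, he, rfl⟩, hb⟩ := Metric.mem_closure_iff.1 (hball v hv) (r / 2) (by linarith)
    refine ⟨e, he, ?_⟩
    rw [dist_eq_norm] at hb
    rw [norm_smul, Real.norm_eq_abs, abs_of_pos (by norm_num : (0 : ℝ) < 2)]
    linarith
  choose g hgK hg using step
  -- The residual is doubled at each stage, so it stays in the same ball; starting at `2d` makes the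
  -- weights `1/2, 1/4, ...` sum to one.
  let next : {v : F // ‖v‖ < r} → {v : F // ‖v‖ < r} := fun v => ⟨(2 : ℝ) • (v.1 - A (g v)), hg v⟩
  have hd2 : ‖(2 : ℝ) • d‖ < r := by
    rw [norm_smul, Real.norm_eq_abs, abs_of_pos (by norm_num : (0 : ℝ) < 2)]
    linarith
  let ρ : ℕ → {v : F // ‖v‖ < r} := fun n => next^[n] ⟨(2 : ℝ) • d, hd2⟩
  have hρ : ∀ n, (ρ (n + 1)).1 = (2 : ℝ) • ((ρ n).1 - A (g (ρ n))) := by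
    intro n
    simp only [ρ, Function.iterate_succ_apply']
    rfl
  let s : ℕ → E := fun n => ∑ k ∈ Finset.range n, ((1 / 2 : ℝ) ^ (k + 1)) • g (ρ k)
  have hs : ∀ n, s (n + 1) = s n + ((1 / 2 : ℝ) ^ (n + 1)) • g (ρ n) := fun n =>
    Finset.sum_range_succ _ n
  have hAs : ∀ n, A (s n) = d - ((1 / 2 : ℝ) ^ (n + 1)) • (ρ n).1 := by
    intro n
    induction n with
    | zero => simp [s, ρ]
    | succ n ih =>
      rw [hs, map_add, ih, hρ, map_smul, smul_smul]
      have : (1 / 2 : ℝ) ^ (n + 1 + 1) * 2 = (1 / 2) ^ (n + 1) := by ring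
      rw [this, smul_sub]
      abel
  -- Partial sums carry mass `1 - 2⁻ⁿ`; any point of `K` supplies the missing mass to complete a
  -- convex combination.
  have hsK : ∀ n, ∀ x ∈ K, s n + ((1 / 2 : ℝ) ^ n) • x ∈ K := by
    intro n
    induction n with
    | zero => intro x hx; simpa [s] using hx
    | succ n ih =>
      intro x hx
      have h1 := ih _ (hK (hgK (ρ n)) hx (by norm_num : (0 : ℝ) ≤ 1 / 2)
        (by norm_num : (0 : ℝ) ≤ 1 / 2) (by norm_num))
      convert h1 using 1
      rw [hs, smul_add, smul_smul, smul_smul, pow_succ, add_assoc]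
  have hR0 : 0 ≤ R := (norm_nonneg _).trans (hR _ (hgK (ρ 0)))
  have hcau : CauchySeq s := by
    refine cauchySeq_of_le_geometric (1 / 2) R (by norm_num) fun n => ?_
    rw [dist_eq_norm, hs, sub_add_cancel_left, norm_neg, norm_smul, Real.norm_eq_abs,
      abs_of_pos (by positivity)]
    have h1 := hR _ (hgK (ρ n))
    have h2 : (0 : ℝ) < (1 / 2) ^ n := by positivity
    calc (1 / 2 : ℝ) ^ (n + 1) * ‖g (ρ n)‖ ≤ (1 / 2) ^ (n + 1) * R := by gcongr
      _ ≤ R * (1 / 2) ^ n := by rw [pow_succ]; nlinarith [mul_nonneg hR0 h2.le]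
  obtain ⟨a, ha⟩ := cauchySeq_tendsto_of_complete hcau
  have hpow : Tendsto (fun n : ℕ => (1 / 2 : ℝ) ^ n) atTop (𝓝 0) :=
    tendsto_pow_atTop_nhds_zero_of_lt_one (by norm_num) (by norm_num)
  refine ⟨a, ?_, ?_⟩
  · have h1 : Tendsto (fun n => s n + ((1 / 2 : ℝ) ^ n) • g (ρ 0)) atTop
        (𝓝 (a + (0 : ℝ) • g (ρ 0))) :=
      ha.add (hpow.smul_const _)
    rw [zero_smul, add_zero] at h1
    exact hKc.mem_of_tendsto h1 (Eventually.of_forall fun n => hsK n _ (hgK _))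
  · have h1 : Tendsto (fun n => A (s n)) atTop (𝓝 (A a)) := (A.continuous.tendsto a).comp ha
    have h2 : Tendsto (fun n => A (s n)) atTop (𝓝 d) := by
      rw [tendsto_iff_norm_sub_tendsto_zero]
      refine squeeze_zero (fun _ => norm_nonneg _) (g := fun n => (1 / 2 : ℝ) ^ n * r) (fun n => ?_)
        (by simpa using hpow.mul_const r)
      rw [hAs, sub_sub_cancel_left, norm_neg, norm_smul, Real.norm_eq_abs,
        abs_of_pos (by positivity)]
      have h3 := (ρ n).2
      have h4 : (0 : ℝ) < (1 / 2) ^ n := by positivity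
      calc (1 / 2 : ℝ) ^ (n + 1) * ‖(ρ n).1‖ ≤ (1 / 2) ^ (n + 1) * r := by gcongr
        _ ≤ (1 / 2) ^ n * r := by rw [pow_succ]; nlinarith [mul_pos hr h4]
    exact tendsto_nhds_unique h1 h2

/-- An open mapping theorem for closed convex sets whose image is absorbing. -/
theorem exists_ball_subset_image_of_absorbing [CompleteSpace F] {K : Set E} (hK : Convex ℝ K)
    (hKc : IsClosed K) (A : E →L[ℝ] F)
    (habs : ∀ v : F, ∃ c : ℝ, 0 < c ∧ ∃ e ∈ K, v = c • A e) :
    ∃ R r : ℝ, 0 < r ∧ ∀ v : F, ‖v‖ < r → ∃ e ∈ K, ‖e‖ ≤ R ∧ A e = v := by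
  let Kn : ℝ → Set E := fun R => K ∩ Metric.closedBall 0 R
  have hKn : ∀ R, Convex ℝ (Kn R) := fun R => hK.inter (convex_closedBall 0 R)
  have hKnc : ∀ R, IsClosed (Kn R) := fun R => hKc.inter Metric.isClosed_closedBall
  have hmono : ∀ {R S : ℝ}, R ≤ S → Kn R ⊆ Kn S := fun h =>
    Set.inter_subset_inter_right _ (Metric.closedBall_subset_closedBall h)
  obtain ⟨e₀, he₀, hAe₀⟩ : ∃ e ∈ K, A e = 0 := by
    obtain ⟨c, hc, e, he, h⟩ := habs 0
    exact ⟨e, he, (smul_eq_zero.1 h.symm).resolve_left hc.ne'⟩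
  -- Baire's theorem applies to dilated closures of images of bounded pieces of `K`; convex
  -- combinations with `e₀`, whose image is zero, shrink `A e` while staying in `K`.
  let f : ℕ → Set F := fun n => {v | ((n + 1 : ℝ)⁻¹) • v ∈ closure (A '' Kn (n + 1))}
  have hf : ∀ n, IsClosed (f n) := fun n => isClosed_closure.preimage (continuous_const_smul _)
  have hU : ⋃ n, f n = Set.univ := by
    refine Set.eq_univ_of_forall fun v => Set.mem_iUnion.2 ?_
    obtain ⟨c, hc, e, he, rfl⟩ := habs v
    obtain ⟨n, hn⟩ := exists_nat_ge (c + ‖e‖ + ‖e₀‖)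
    have hN : (0 : ℝ) < n + 1 := by positivity
    refine ⟨n, subset_closure ⟨(c / (n + 1)) • e + (1 - c / (n + 1)) • e₀, ?_, ?_⟩⟩
    · have h0 : 0 ≤ c / ((n : ℝ) + 1) := by positivity
      have h1 : c / ((n : ℝ) + 1) ≤ 1 := by
        rw [div_le_one hN]; linarith [norm_nonneg e, norm_nonneg e₀]
      refine (hKn _) ⟨he, ?_⟩ ⟨he₀, ?_⟩ h0 (by linarith) (by ring)
      · rw [mem_closedBall_zero_iff]; linarith [norm_nonneg e₀]
      · rw [mem_closedBall_zero_iff]; linarith [norm_nonneg e]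
    · rw [map_add, map_smul, map_smul, hAe₀, smul_zero, add_zero, smul_smul, div_eq_inv_mul]
  obtain ⟨n, a, ha⟩ := nonempty_interior_of_iUnion_of_closed hf hU
  obtain ⟨ε, hε, hball⟩ := Metric.isOpen_iff.1 isOpen_interior a ha
  -- The interior point `a` need not be zero; averaging with a preimage of a multiple of `-a`
  -- recentres the ball at the origin.
  obtain ⟨c, hc, e, he, hce⟩ := habs (-a)
  set R : ℝ := max (n + 1) ‖e‖ with hRdef
  have hN : (0 : ℝ) < n + 1 := by positivity
  have hNc : (0 : ℝ) < n + 1 + c := by positivity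
  have hC : Convex ℝ (closure (A '' Kn R)) := ((hKn R).linear_image A.toLinearMap).closure
  refine ⟨R, ε / (n + 1 + c) / 2, by positivity, fun v hv => ?_⟩
  obtain ⟨x, hx, hxv⟩ := ball_half_subset_image_of_subset_closure_image (hKn R) (hKnc R)
    (fun e he => mem_closedBall_zero_iff.1 he.2) A (r := ε / (n + 1 + c)) (fun z hz => by
      have h1 : a + (n + 1 + c : ℝ) • z ∈ f n := by
        refine interior_subset (hball ?_)
        rw [Metric.mem_ball, dist_eq_norm, add_sub_cancel_left, norm_smul, Real.norm_eq_abs,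
          abs_of_pos hNc]
        rwa [lt_div_iff₀ hNc, mul_comm] at hz
      have h2 : ((n + 1 : ℝ)⁻¹) • (a + (n + 1 + c : ℝ) • z) ∈ closure (A '' Kn R) :=
        closure_mono (Set.image_mono (hmono (le_max_left _ _))) h1
      have h3 : A e ∈ closure (A '' Kn R) :=
        subset_closure ⟨e, ⟨he, mem_closedBall_zero_iff.2 (le_max_right _ _)⟩, rfl⟩
      have h4 := hC h2 h3 (a := (n + 1) / (n + 1 + c)) (b := c / (n + 1 + c)) (by positivity)
        (by positivity) (by field_simp)
      convert h4 using 1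
      have h5 : (c / (n + 1 + c)) • A e = (-((n + 1 + c : ℝ)⁻¹)) • a := by
        rw [neg_smul, ← smul_neg, hce, smul_smul, div_eq_inv_mul]
      rw [h5, smul_add, smul_add, smul_smul, smul_smul, smul_smul, neg_smul]
      have h6 : (n + 1) / (n + 1 + c) * ((n : ℝ) + 1)⁻¹ = (n + 1 + c)⁻¹ := by field_simp
      rw [h6, inv_mul_cancel₀ hNc.ne', one_smul]
      abel) v hv
  exact ⟨x, hx.1, mem_closedBall_zero_iff.1 hx.2, hxv⟩

/-- Lagrange multipliers for a linear objective on a closed convex set with absorbing image. -/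
theorem exists_multiplier_of_absorbing [CompleteSpace F] {K : Set E} (hK : Convex ℝ K)
    (hKc : IsClosed K) (A : E →L[ℝ] F) (B : StrongDual ℝ E)
    (habs : ∀ v : F, ∃ c : ℝ, 0 < c ∧ ∃ e ∈ K, v = c • A e) {β : ℝ}
    (hβ : ∀ e ∈ K, A e = 0 → β ≤ B e) :
    ∃ u : StrongDual ℝ F, ∀ e ∈ K, u (A e) + β ≤ B e := by
  obtain ⟨R, r, hr, hball⟩ := exists_ball_subset_image_of_absorbing hK hKc A habs
  let S : Set (F × ℝ) := {q | ∃ e ∈ K, A e = q.1 ∧ B e - β ≤ q.2}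
  have hS : Convex ℝ S := by
    rintro ⟨d, t⟩ ⟨e, he, rfl, ht⟩ ⟨d', t'⟩ ⟨e', he', rfl, ht'⟩ a b ha hb hab
    refine ⟨a • e + b • e', hK he he' ha hb hab, by simp, ?_⟩
    simp only [map_add, map_smul, smul_eq_mul, Prod.snd_add, Prod.smul_snd] at *
    have := mul_le_mul_of_nonneg_left ht ha
    have := mul_le_mul_of_nonneg_left ht' hb
    have h5 : β = a * β + b * β := by rw [← add_mul, hab, one_mul]
    linarith
  -- Norm-bounded preimages bound the objective over a whole ball, which gives `S` interior points
  -- above the origin and forces a nonvertical separating hyperplane.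
  set M : ℝ := ‖B‖ * R - β with hM
  have hsub : Metric.ball (0 : F) r ×ˢ Set.Ioi M ⊆ S := by
    rintro ⟨d, t⟩ ⟨hd, ht⟩
    obtain ⟨e, he, heR, hAe⟩ := hball d (mem_ball_zero_iff.1 hd)
    refine ⟨e, he, hAe, ?_⟩
    have h1 : B e ≤ ‖B‖ * R := (le_abs_self _).trans
      ((B.le_opNorm e).trans (mul_le_mul_of_nonneg_left heR (norm_nonneg _)))
    have h2 : M < t := ht
    change B e - β ≤ t
    linarith
  have hopen : IsOpen (Metric.ball (0 : F) r ×ˢ Set.Ioi M) := Metric.isOpen_ball.prod isOpen_Ioi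
  have hint : ∀ t, M < t → ((0 : F), t) ∈ interior S := fun t ht =>
    interior_maximal hsub hopen ⟨Metric.mem_ball_self hr, ht⟩
  have h0 : ((0 : F), (0 : ℝ)) ∉ interior S := by
    intro h
    have hc : Continuous fun t : ℝ => ((0 : F), t) := by fun_prop
    obtain ⟨ε, hε, hb⟩ := Metric.isOpen_iff.1 (isOpen_interior.preimage hc) 0 h
    have hm : (-(ε / 2)) ∈ Metric.ball (0 : ℝ) ε := by
      rw [mem_ball_zero_iff, Real.norm_eq_abs, abs_neg, abs_of_pos (by positivity)]; linarith
    obtain ⟨e, he, hAe, hBe⟩ := interior_subset (hb hm)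
    have := hβ e he hAe
    change B e - β ≤ -(ε / 2) at hBe
    linarith
  obtain ⟨f, hf⟩ := geometric_hahn_banach_open_point hS.interior isOpen_interior h0
  have hfS : ∀ q ∈ S, f q ≤ 0 := fun q hq => by
    have h1 : q ∈ closure (interior S) := by
      rw [hS.closure_interior_eq_closure_of_nonempty_interior ⟨_, hint (M + 1) (by linarith)⟩]
      exact subset_closure hq
    refine closure_minimal (fun x hx => ?_) (isClosed_Iic.preimage f.continuous) h1
    have := hf x hx
    rw [show ((0 : F), (0 : ℝ)) = 0 from rfl, map_zero] at this
    exact this.le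
  have hsplit : ∀ d t, f (d, t) = f (d, 0) + t * f (0, 1) := fun d t => by
    have : ((d, t) : F × ℝ) = (d, 0) + t • (0, 1) := by simp
    rw [this, map_add, map_smul, smul_eq_mul]
  have hc : f (0, 1) < 0 := by
    have h1 := hf _ (hint (max (M + 1) 1) (lt_max_of_lt_left (by linarith)))
    rw [hsplit 0 (max (M + 1) 1), show ((0 : F), (0 : ℝ)) = 0 from rfl, map_zero, zero_add] at h1
    have : (0 : ℝ) < max (M + 1) 1 := lt_max_of_lt_right one_pos
    by_contra hneg
    nlinarith [mul_nonneg this.le (not_lt.1 hneg)]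
  refine ⟨(-(f (0, 1)))⁻¹ • f.comp (ContinuousLinearMap.inl ℝ F ℝ), fun e he => ?_⟩
  have h1 := hfS (A e, B e - β) ⟨e, he, rfl, le_rfl⟩
  rw [hsplit] at h1
  have h2 : 0 < -(f (0, 1)) := by linarith
  have h3 : (-(f (0, 1)))⁻¹ * f (A e, 0) ≤ B e - β := by
    rw [inv_mul_le_iff₀ h2]; linarith
  simpa using (by linarith : (-(f (0, 1)))⁻¹ * f (A e, 0) + β ≤ B e)

/-- Lagrange multipliers when the image is absorbing in a closed subspace. -/
theorem exists_multiplier_of_absorbing_submodule {X : Type*} [NormedAddCommGroup X]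
    [NormedSpace ℝ X] [CompleteSpace X] {K : Set E} (hK : Convex ℝ K)
    (hKc : IsClosed K) (A : E →L[ℝ] X) (B : StrongDual ℝ E) (V : Submodule ℝ X)
    (hV : IsClosed (V : Set X)) (hAK : ∀ e ∈ K, A e ∈ V)
    (habs : ∀ v ∈ V, ∃ c : ℝ, 0 < c ∧ ∃ e ∈ K, v = c • A e) {β : ℝ}
    (hβ : ∀ e ∈ K, A e = 0 → β ≤ B e) :
    ∃ u : StrongDual ℝ X, ∀ e ∈ K, u (A e) + β ≤ B e := by
  have : CompleteSpace V := hV.completeSpace_coe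
  let W : Submodule ℝ E := V.comap A.toLinearMap
  have hW : IsClosed (W : Set E) := hV.preimage A.continuous
  have : CompleteSpace W := hW.completeSpace_coe
  let A' : W →L[ℝ] V := (A.comp W.subtypeL).codRestrict V fun w => w.2
  obtain ⟨u, hu⟩ := exists_multiplier_of_absorbing (K := W.subtypeL ⁻¹' K) (β := β)
    (hK.linear_preimage W.subtypeL.toLinearMap) (hKc.preimage W.subtypeL.continuous) A'
    (B.comp W.subtypeL)
    (fun v => by
      obtain ⟨c, hc, e, he, h⟩ := habs v v.2
      exact ⟨c, hc, ⟨e, hAK e he⟩, he, Subtype.ext h⟩)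
    (fun e he h => hβ e he (congrArg Subtype.val h))
  obtain ⟨g, hg, -⟩ := exists_extension_norm_eq V u
  refine ⟨g, fun e he => ?_⟩
  have h1 := hu ⟨e, hAK e he⟩ he
  have h2 := hg ⟨A e, hAK e he⟩
  rw [h2]
  exact h1

end ConvexOpenMapping

/-! ### Conjugates expressed through real upper bounds -/

section

section EReal

theorem coe_le_iff_forall_real {a : ℝ} {y : EReal} :
    (a : EReal) ≤ y ↔ ∀ s : ℝ, y ≤ s → a ≤ s := by
  induction y with
  | bot =>
    simp only [le_bot_iff, EReal.coe_ne_bot, bot_le, forall_const, false_iff, not_forall, not_le]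
    exact ⟨a - 1, by linarith⟩
  | top => simp
  | coe y =>
    simp only [EReal.coe_le_coe_iff]
    exact ⟨fun h s hs => h.trans hs, fun h => h y le_rfl⟩

/-- Quantifying over real upper bounds of `y` treats infinite values uniformly and reduces conjugate
inequalities to real arithmetic. -/
theorem coe_sub_le_coe_iff {a r : ℝ} {y : EReal} :
    (a : EReal) - y ≤ r ↔ ∀ s : ℝ, y ≤ s → a - r ≤ s := by
  rw [← coe_le_iff_forall_real]
  induction y with
  | bot => simp [-EReal.coe_sub]
  | top => simp
  | coe y =>
    rw [← EReal.coe_sub, EReal.coe_le_coe_iff, EReal.coe_le_coe_iff]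
    constructor <;> intro h <;> linarith

end EReal

variable {X : Type*} [NormedAddCommGroup X] [NormedSpace ℝ X]

section Conjugate

variable {h : X × StrongDual ℝ X → EReal}

theorem pairConjugate_le_coe_iff {q : StrongDual ℝ X × StrongDual ℝ (StrongDual ℝ X)} {r : ℝ} :
    pairConjugate h q ≤ r ↔ ∀ z (s : ℝ), h z ≤ s → q.1 z.1 + q.2 z.2 - r ≤ s := by
  simp only [pairConjugate, conjugate, iSup_le_iff, coe_sub_le_coe_iff,
    ContinuousLinearMap.coprod_apply]

theorem transposeConj_le_coe_iff {p : X × StrongDual ℝ X} {r : ℝ} :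
    transposeConj h p ≤ r ↔ ∀ z (s : ℝ), h z ≤ s → p.2 z.1 + z.2 p.1 - r ≤ s :=
  pairConjugate_le_coe_iff

theorem pairing_le_pairConjugate_iff {q : StrongDual ℝ X × StrongDual ℝ (StrongDual ℝ X)} :
    (pairing q : EReal) ≤ pairConjugate h q ↔
      ∀ r : ℝ, (∀ z (s : ℝ), h z ≤ s → q.1 z.1 + q.2 z.2 - r ≤ s) → pairing q ≤ r := by
  simp only [coe_le_iff_forall_real, pairConjugate_le_coe_iff]

theorem isConvexFun_transposeConj : IsConvexFun (transposeConj h) := by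
  rintro ⟨p, s⟩ hp ⟨q, t⟩ hq a b ha hb hab
  simp only [Set.mem_ofPred_eq, transposeConj_le_coe_iff] at hp hq ⊢
  intro z r hz
  have h1 := mul_le_mul_of_nonneg_left (hp z r hz) ha
  have h2 := mul_le_mul_of_nonneg_left (hq z r hz) hb
  have h3 : r = a * r + b * r := by rw [← add_mul, hab, one_mul]
  simp only [Prod.smul_mk, Prod.mk_add_mk, Prod.snd_add, Prod.smul_snd, Prod.fst_add,
    Prod.smul_fst, add_apply, smul_apply, map_add, map_smul,
    smul_eq_mul]
  linarith

theorem lowerSemicontinuous_of_isClosed_sublevel {E : Type*} [TopologicalSpace E] {f : E → EReal}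
    (hf : ∀ r : ℝ, IsClosed {x | f x ≤ r}) : LowerSemicontinuous f := by
  rw [lowerSemicontinuous_iff_isClosed_preimage]
  intro y
  induction y with
  | bot =>
    have : f ⁻¹' Set.Iic ⊥ = ⋂ r : ℝ, {x | f x ≤ r} := by
      ext x
      simp only [Set.mem_preimage, Set.mem_Iic, Set.mem_iInter, Set.mem_ofPred_eq]
      refine ⟨fun hx r => hx.trans bot_le, fun hx => ?_⟩
      rw [le_bot_iff, EReal.eq_bot_iff_forall_lt]
      intro r
      refine (hx (r - 1)).trans_lt ?_
      rw [EReal.coe_lt_coe_iff]; linarith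
    rw [this]
    exact isClosed_iInter hf
  | top => simp
  | coe y => exact hf y

theorem lowerSemicontinuous_transposeConj : LowerSemicontinuous (transposeConj h) := by
  refine lowerSemicontinuous_of_isClosed_sublevel fun r => ?_
  simp only [transposeConj_le_coe_iff, Set.ofPred_forall]
  refine isClosed_iInter fun z => isClosed_iInter fun s => isClosed_iInter fun _ => ?_
  refine isClosed_le ?_ continuous_const
  fun_prop

end Conjugate

theorem continuous_pairing : Continuous (pairing : X × StrongDual ℝ X → ℝ) := by
  unfold pairing
  fun_prop

/-! ### Contact sets of convex majorants of the duality product -/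

section Fitzpatrick

variable {H : X × StrongDual ℝ X → EReal}

/-- Convexity evaluated on real upper bounds. -/
theorem IsConvexFun.le_combo {E : Type*} [AddCommGroup E] [Module ℝ E] {f : E → EReal}
    (hf : IsConvexFun f) {p q : E} {s t a b : ℝ} (hp : f p ≤ s) (hq : f q ≤ t) (ha : 0 ≤ a)
    (hb : 0 ≤ b) (hab : a + b = 1) : f (a • p + b • q) ≤ ((a * s + b * t : ℝ) : EReal) :=
  hf (x := (p, s)) hp (y := (q, t)) hq ha hb hab

/-- A convex majorant of `π` lies above the affine minorants given by its contact points. -/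
theorem cross_le_of_le_pairing (hconv : IsConvexFun H)
    (hπ : ∀ p, (pairing p : EReal) ≤ H p) {p : X × StrongDual ℝ X} (hp : H p ≤ pairing p)
    {q : X × StrongDual ℝ X} {s : ℝ} (hq : H q ≤ s) :
    p.2 q.1 + q.2 p.1 - pairing p ≤ s := by
  -- Compare `π` and `H` on the segment from `p` to `q`, cancel the contact value, divide by `t`,
  -- then let `t` tend to zero.
  have key : ∀ t : ℝ, 0 < t → t < 1 → p.2 q.1 + q.2 p.1 - pairing p ≤
      s + t * (p.2 q.1 + q.2 p.1 - pairing p - pairing q) := by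
    intro t ht ht1
    have h1 := (hπ _).trans (hconv.le_combo hp hq (by linarith : (0 : ℝ) ≤ 1 - t) ht.le (by ring))
    rw [EReal.coe_le_coe_iff] at h1
    simp only [pairing, Prod.snd_add, Prod.smul_snd, Prod.fst_add, Prod.smul_fst,
      add_apply, smul_apply, map_add, map_smul,
      smul_eq_mul] at h1 ⊢
    refine le_of_mul_le_mul_left ?_ ht
    nlinarith [h1]
  have hlim : Tendsto (fun t : ℝ => s + t * (p.2 q.1 + q.2 p.1 - pairing p - pairing q))
      (𝓝[>] 0) (𝓝 (s + 0 * (p.2 q.1 + q.2 p.1 - pairing p - pairing q))) := by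
    refine Tendsto.mono_left ?_ nhdsWithin_le_nhds
    exact (by fun_prop : Continuous fun t : ℝ =>
      s + t * (p.2 q.1 + q.2 p.1 - pairing p - pairing q)).tendsto 0
  rw [zero_mul, add_zero] at hlim
  refine ge_of_tendsto hlim ?_
  filter_upwards [Ioo_mem_nhdsGT (zero_lt_one' ℝ)] with t ht using key t ht.1 ht.2

/-- The contact set of a convex majorant of `π` is monotone. -/
theorem isMonotoneOp_contact (hconv : IsConvexFun H) (hπ : ∀ p, (pairing p : EReal) ≤ H p) :
    IsMonotoneOp {p | H p = (pairing p : EReal)} := by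
  intro p hp q hq
  have h1 := cross_le_of_le_pairing hconv hπ (le_of_eq hp) (le_of_eq hq)
  simp only [pairing, sub_apply, map_sub] at h1 ⊢
  linarith

theorem contact_eq_setOf_le (hπ : ∀ p, (pairing p : EReal) ≤ H p) :
    {p | H p = (pairing p : EReal)} = {p | H p ≤ (pairing p : EReal)} := by
  ext p
  exact ⟨fun h => le_of_eq h, fun h => le_antisymm h (hπ p)⟩

theorem isClosed_contact (hlsc : LowerSemicontinuous H) (hπ : ∀ p, (pairing p : EReal) ≤ H p) :
    IsClosed {p | H p = (pairing p : EReal)} := by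
  rw [contact_eq_setOf_le hπ]
  have h1 := (lowerSemicontinuous_iff_isClosed_epigraph.1 hlsc)
  exact h1.preimage (f := fun p => (p, (pairing p : EReal)))
    (continuous_id.prodMk (continuous_coe_real_ereal.comp continuous_pairing))

/-- Members of the Fitzpatrick family of an operator of type NI have conjugates above `π_*`. -/
theorem pairing_le_pairConjugate_of_isTypeNI {T : Set (X × StrongDual ℝ X)} (hT : IsTypeNI T)
    (hH : ∀ p ∈ T, H p = (pairing p : EReal)) (q : StrongDual ℝ X × StrongDual ℝ (StrongDual ℝ X)) :
    (pairing q : EReal) ≤ pairConjugate H q := by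
  rw [pairing_le_pairConjugate_iff]
  intro r hr
  have h1 : ((pairing q - r : ℝ) : EReal) ≤ (0 : ℝ) := by
    refine le_trans (le_iInf₂ fun p hp => ?_) (hT q.1 q.2)
    rw [EReal.coe_le_coe_iff]
    have h2 := hr p (pairing p) (le_of_eq (hH p hp))
    simp only [pairing, sub_apply, map_sub,
      NormedSpace.dual_def] at h2 ⊢
    linarith
  rw [EReal.coe_le_coe_iff] at h1
  linarith

/-- The affine minorant at a contact point is exactly the upper bound on the conjugate; the lower
bound is `H* ≥ π_*`. -/
theorem transposeConj_eq_pairing_of_contact (hconv : IsConvexFun H)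
    (hπ : ∀ p, (pairing p : EReal) ≤ H p)
    (hπs : ∀ q, (pairing q : EReal) ≤ pairConjugate H q) {p : X × StrongDual ℝ X}
    (hp : H p = (pairing p : EReal)) : transposeConj H p = (pairing p : EReal) := by
  refine le_antisymm (transposeConj_le_coe_iff.2 fun z s hz => ?_) 
      (hπs (p.2, NormedSpace.inclusionInDoubleDual ℝ X p.1))
  have := cross_le_of_le_pairing hconv hπ (le_of_eq hp) hz
  linarith

/-- A convex majorant of `π` which touches it on a maximal monotone operator touches it nowhere
else. -/
theorem contact_eq_of_isMaximalMonotoneOp (hconv : IsConvexFun H)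
    (hπ : ∀ p, (pairing p : EReal) ≤ H p) {T : Set (X × StrongDual ℝ X)}
    (hT : IsMaximalMonotoneOp T) (hHT : ∀ p ∈ T, H p = (pairing p : EReal)) :
    {p | H p = (pairing p : EReal)} = T :=
  (hT.eq_of_ge (isMonotoneOp_contact hconv hπ) hHT)

end Fitzpatrick

end

/-! ### Quadratic weights and Fenchel duality -/

section

variable {X : Type*} [NormedAddCommGroup X] [NormedSpace ℝ X]

/-- The convex weight `μ‖x‖²/2 + ‖x*‖²/(2μ)` on `X × X*`, which dominates `|π|`. -/
noncomputable def weight (μ : ℝ) (p : X × StrongDual ℝ X) : ℝ :=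
  μ / 2 * ‖p.1‖ ^ 2 + (2 * μ)⁻¹ * ‖p.2‖ ^ 2

section Weight

variable {μ : ℝ}

theorem continuous_weight : Continuous (weight μ : X × StrongDual ℝ X → ℝ) := by
  unfold weight
  fun_prop

theorem norm_mul_norm_le_weight (hμ : 0 < μ) (p : X × StrongDual ℝ X) :
    ‖p.1‖ * ‖p.2‖ ≤ weight μ p := by
  have h1 : weight μ p - ‖p.1‖ * ‖p.2‖ = (2 * μ)⁻¹ * (μ * ‖p.1‖ - ‖p.2‖) ^ 2 := by
    unfold weight
    field_simp
    ring
  have h2 : 0 ≤ (2 * μ)⁻¹ * (μ * ‖p.1‖ - ‖p.2‖) ^ 2 := by positivity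
  linarith

theorem abs_pairing_le (p : X × StrongDual ℝ X) : |pairing p| ≤ ‖p.1‖ * ‖p.2‖ := by
  rw [mul_comm]
  exact p.2.le_opNorm p.1

theorem neg_weight_le_pairing (hμ : 0 < μ) (p : X × StrongDual ℝ X) :
    -weight μ p ≤ pairing p :=
  (neg_le_neg ((abs_pairing_le p).trans (norm_mul_norm_le_weight hμ p))).trans
    (neg_abs_le _)

theorem convexOn_weight (hμ : 0 < μ) :
    ConvexOn ℝ Set.univ (weight μ : X × StrongDual ℝ X → ℝ) := by
  have h1 : ConvexOn ℝ Set.univ fun p : X × StrongDual ℝ X => ‖p.1‖ ^ 2 :=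
    (convexOn_univ_norm.pow (fun _ _ => norm_nonneg _) 2).comp_linearMap
      (LinearMap.fst ℝ X (StrongDual ℝ X))
  have h2 : ConvexOn ℝ Set.univ fun p : X × StrongDual ℝ X => ‖p.2‖ ^ 2 :=
    (convexOn_univ_norm.pow (fun _ _ => norm_nonneg _) 2).comp_linearMap
      (LinearMap.snd ℝ X (StrongDual ℝ X))
  exact (h1.smul (by positivity : 0 ≤ μ / 2)).add (h2.smul (by positivity : 0 ≤ (2 * μ)⁻¹))

/-- The unequal Young constants matter: after halving the argument, the first becomes `3/8`, still
below the coefficient `1/2` available in `weight_le_of_almost_min`. -/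
theorem weight_add_le (hμ : 0 < μ) (p q : X × StrongDual ℝ X) :
    weight μ (p + q) ≤ 3 / 2 * weight μ p + 3 * weight μ q := by
  have key : ∀ {E : Type _} [NormedAddCommGroup E] (a b : E),
      ‖a + b‖ ^ 2 ≤ 3 / 2 * ‖a‖ ^ 2 + 3 * ‖b‖ ^ 2 := by
    intro E _ a b
    have h1 := norm_add_le a b
    have h2 : ‖a + b‖ ^ 2 ≤ (‖a‖ + ‖b‖) ^ 2 := by gcongr
    nlinarith [sq_nonneg (‖a‖ - 2 * ‖b‖)]
  have h1 := mul_le_mul_of_nonneg_left (key p.1 q.1) (by positivity : 0 ≤ μ / 2)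
  have h2 := mul_le_mul_of_nonneg_left (key p.2 q.2) (by positivity : 0 ≤ (2 * μ)⁻¹)
  unfold weight
  simp only [Prod.fst_add, Prod.snd_add]
  linarith

theorem weight_half_smul (p : X × StrongDual ℝ X) :
    weight μ ((1 / 2 : ℝ) • p) = weight μ p / 4 := by
  simp only [weight, Prod.smul_fst, Prod.smul_snd, norm_smul, Real.norm_eq_abs]
  rw [abs_of_pos (by norm_num : (0 : ℝ) < 1 / 2)]
  ring

end Weight

/-- If `a + μ‖·‖²/2` is bounded below by `L`, then `‖a‖² ≤ -2μL`. -/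
theorem norm_sq_le_of_le_add_sq {E : Type*} [NormedAddCommGroup E] [NormedSpace ℝ E]
    (a : StrongDual ℝ E) {μ L : ℝ} (hμ : 0 < μ) (h : ∀ e, L ≤ a e + μ / 2 * ‖e‖ ^ 2) :
    ‖a‖ ^ 2 ≤ 2 * μ * -L := by
  have hL : 0 ≤ -L := by simpa using h 0
  have h1 : ‖a‖ ≤ √(2 * μ * -L) := by
    refine a.opNorm_le_bound (Real.sqrt_nonneg _) fun e => ?_
    rw [Real.norm_eq_abs]
    refine abs_le_of_sq_le_sq ?_ (by positivity)
    rw [mul_pow, Real.sq_sqrt (by positivity)]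
    have h2 : ∀ s : ℝ, 0 ≤ (μ / 2 * ‖e‖ ^ 2) * (s * s) + a e * s + -L := fun s => by
      have := h (s • e)
      rw [map_smul, norm_smul, mul_pow, Real.norm_eq_abs, sq_abs, smul_eq_mul] at this
      linarith
    have h3 := discrim_le_zero h2
    rw [discrim] at h3
    linarith
  calc ‖a‖ ^ 2 ≤ √(2 * μ * -L) ^ 2 := by gcongr
    _ = 2 * μ * -L := Real.sq_sqrt (by positivity)

variable {H : X × StrongDual ℝ X → EReal}

/-- If `H` were identically `⊤`, its conjugate would be `⊥` at the origin, where `π_*` vanishes. -/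
theorem exists_le_coe_of_pairing_le_pairConjugate
    (hπs : ∀ q, (pairing q : EReal) ≤ pairConjugate H q) : ∃ p, ∃ t : ℝ, H p ≤ t := by
  by_contra hne
  push Not at hne
  have h1 := pairing_le_pairConjugate_iff.1 (hπs 0) (-1)
    fun z s hz => absurd hz (not_le.2 (hne z s))
  simp only [pairing, Prod.fst_zero, Prod.snd_zero, map_zero] at h1
  linarith

/-- Fenchel duality for `H` against a translated weight: the perturbed infimum at any point of
`X × X*` is nonpositive. -/
theorem exists_weight_lt (hconv : IsConvexFun H)
    (hπs : ∀ q, (pairing q : EReal) ≤ pairConjugate H q) (w : X × StrongDual ℝ X) {μ ε : ℝ}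
    (hμ : 0 < μ) (hε : 0 < ε) :
    ∃ d, ∃ t : ℝ, H d ≤ t ∧ t - (w.2 d.1 + d.2 w.1) + pairing w + weight μ (d - w) < ε := by
  by_contra hne
  push Not at hne
  -- If the claim fails, the epigraph of `H` misses this open strict hypograph of a concave
  -- function; separation then gives an affine minorant of `H` with slope `q ∈ X* × X**`.
  let O : Set ((X × StrongDual ℝ X) × ℝ) :=
    {q | q.2 - (w.2 q.1.1 + q.1.2 w.1) + pairing w + weight μ (q.1 - w) < ε}
  have hO : IsOpen O := by
    refine isOpen_lt ?_ continuous_const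
    have := (continuous_weight (X := X) (μ := μ)).comp
      ((continuous_fst (X := X × StrongDual ℝ X) (Y := ℝ)).sub (continuous_const (y := w)))
    have h2 : Continuous fun q : (X × StrongDual ℝ X) × ℝ => weight μ (q.1 - w) := this
    fun_prop
  have hOc : Convex ℝ O := by
    rintro ⟨p, s⟩ hp ⟨q, t⟩ hq a b ha hb hab
    have h1 := (convexOn_weight (X := X) hμ).2 (Set.mem_univ (p - w)) (Set.mem_univ (q - w)) ha hb
      hab
    have h2 : a • (p - w) + b • (q - w) = a • p + b • q - w := by
      have : w = a • w + b • w := by rw [← add_smul, hab, one_smul]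
      nth_rewrite 3 [this]
      rw [smul_sub, smul_sub]
      abel
    rw [h2] at h1
    simp only [O, Set.mem_ofPred_eq, Prod.smul_mk, Prod.mk_add_mk, Prod.snd_add, Prod.smul_snd,
      Prod.fst_add, Prod.smul_fst, add_apply, smul_apply, map_add, map_smul, smul_eq_mul]
      at hp hq h1 ⊢
    have h3 : pairing w = a * pairing w + b * pairing w := by rw [← add_mul, hab, one_mul]
    have h4 : ε = a * ε + b * ε := by rw [← add_mul, hab, one_mul]
    rcases ha.eq_or_lt with rfl | ha
    · have hb1 : b = 1 := by linarith
      subst hb1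
      linarith
    · have h5 := mul_lt_mul_of_pos_left hp ha
      have h6 := mul_le_mul_of_nonneg_left hq.le hb
      linarith
  have hdisj : Disjoint O {q : (X × StrongDual ℝ X) × ℝ | H q.1 ≤ (q.2 : EReal)} :=
    Set.disjoint_left.2 fun q hq hq' => absurd hq (not_lt.2 (hne q.1 q.2 hq'))
  obtain ⟨f, u, hfO, hfH⟩ := geometric_hahn_banach_open hOc hO hconv hdisj
  have hsplit : ∀ d t, f (d, t) = f (d, 0) + t * f (0, 1) := fun d t => by
    have : ((d, t) : (X × StrongDual ℝ X) × ℝ) = (d, 0) + t • (0, 1) := by simp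
    rw [this, map_add, map_smul, smul_eq_mul]
  set c := f (0, 1) with hcdef
  obtain ⟨d₀, t₀, hd₀⟩ := exists_le_coe_of_pairing_le_pairConjugate hπs
  have hc : 0 < c := by
    set t := min (t₀ - 1) ((w.2 d₀.1 + d₀.2 w.1) - pairing w - weight μ (d₀ - w)) with ht
    have h1 : (d₀, t) ∈ O := by
      change t - (w.2 d₀.1 + d₀.2 w.1) + pairing w + weight μ (d₀ - w) < ε
      have := min_le_right (t₀ - 1) ((w.2 d₀.1 + d₀.2 w.1) - pairing w - weight μ (d₀ - w))
      linarith
    have h2 := hfO _ h1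
    have h3 := hfH (d₀, t₀) hd₀
    rw [hsplit] at h2 h3
    have h4 : t ≤ t₀ - 1 := min_le_left _ _
    by_contra hneg
    nlinarith [mul_nonneg (by linarith : 0 ≤ t₀ - t) (by linarith : 0 ≤ -c)]
  let ψ : StrongDual ℝ (X × StrongDual ℝ X) :=
    -(c⁻¹ • f.comp (ContinuousLinearMap.inl ℝ (X × StrongDual ℝ X) ℝ))
  have hψ : ∀ d, f (d, 0) = -(c * ψ d) := fun d => by
    simp only [ψ, neg_apply, smul_apply, smul_eq_mul, ContinuousLinearMap.comp_apply,
      ContinuousLinearMap.inl_apply]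
    field_simp
  let q : StrongDual ℝ X × StrongDual ℝ (StrongDual ℝ X) :=
    (ψ.comp (ContinuousLinearMap.inl ℝ X (StrongDual ℝ X)),
      ψ.comp (ContinuousLinearMap.inr ℝ X (StrongDual ℝ X)))
  have hq : ∀ d, ψ d = q.1 d.1 + q.2 d.2 := fun d => by
    simp only [q, ContinuousLinearMap.comp_apply, ContinuousLinearMap.inl_apply,
      ContinuousLinearMap.inr_apply, ← map_add]
    simp
  set ρ := u / c with hρ
  have hu : u = c * ρ := by rw [hρ]; field_simp
  have hπq : pairing q ≤ -ρ := by
    refine pairing_le_pairConjugate_iff.1 (hπs q) (-ρ) fun z s hz => ?_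
    have h1 := hfH (z, s) hz
    rw [hsplit, hψ, hq, hu] at h1
    nlinarith
  have hlow : ∀ e : X × StrongDual ℝ X, ε + pairing w - (q.1 w.1 + q.2 w.2) - ρ ≤
      (q.1 - w.2) e.1 + (q.2 - NormedSpace.inclusionInDoubleDual ℝ X w.1) e.2 + weight μ e := by
    intro e
    refine le_of_forall_pos_lt_add fun δ hδ => ?_
    set t := ε - δ + (w.2 (w + e).1 + (w + e).2 w.1) - pairing w - weight μ e with ht
    have h1 : (w + e, t) ∈ O := by
      change t - (w.2 (w + e).1 + (w + e).2 w.1) + pairing w + weight μ (w + e - w) < ε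
      rw [add_sub_cancel_left]
      linarith
    have h2 := hfO _ h1
    rw [hsplit, hψ, hq, hu] at h2
    have h3 : -(q.1 (w + e).1 + q.2 (w + e).2) + t < ρ := by
      refine lt_of_mul_lt_mul_left ?_ hc.le
      linarith
    rw [ht] at h3
    simp only [pairing, Prod.fst_add, Prod.snd_add, map_add, add_apply, sub_apply,
      NormedSpace.dual_def] at h3 ⊢
    linarith
  set L := ε + pairing w - (q.1 w.1 + q.2 w.2) - ρ with hL
  set a := q.1 - w.2 with ha
  set b := q.2 - NormedSpace.inclusionInDoubleDual ℝ X w.1 with hb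
  -- Inserting `a` itself as the second component turns `b e.2` into `b a`; minimizing over the
  -- first component cancels the quadratic terms and leaves `L ≤ b a`, that is `ε - ρ ≤ π_*(q)`,
  -- against `π_*(q) ≤ -ρ`.
  have h1 := norm_sq_le_of_le_add_sq a hμ (L := L - b a - (2 * μ)⁻¹ * ‖a‖ ^ 2) fun e => by
    have := hlow (e, a)
    simp only [weight] at this
    linarith
  have h2 : L ≤ b a := by
    have h3 : 2 * μ * ((2 * μ)⁻¹ * ‖a‖ ^ 2) = ‖a‖ ^ 2 := by field_simp
    have h4 : 2 * μ * L ≤ 2 * μ * b a := by nlinarith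
    exact le_of_mul_le_mul_left h4 (by positivity)
  rw [hL, hb, ha] at h2
  simp only [pairing, map_sub, sub_apply, NormedSpace.dual_def] at h2 hπq
  linarith

/-- The translate of the preceding infimum controls both the gap and the weight. -/
theorem gap_and_weight_le (hπ : ∀ p, (pairing p : EReal) ≤ H p) {w d : X × StrongDual ℝ X}
    {μ ε t : ℝ} (hμ : 0 < μ) (hd : H d ≤ t)
    (h : t - (w.2 d.1 + d.2 w.1) + pairing w + weight μ (d - w) ≤ ε) :
    H d ≤ ((pairing d + ε : ℝ) : EReal) ∧ pairing (d - w) + weight μ (d - w) ≤ ε := by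
  have h1 : pairing d ≤ t := EReal.coe_le_coe_iff.1 ((hπ d).trans hd)
  have h2 := neg_weight_le_pairing hμ (d - w)
  -- The perturbed value splits into the gap `t - π(d)` and `π(d - w) + weight μ (d - w)`, both
  -- nonnegative, so each is at most `ε`.
  have h3 : pairing (d - w) = pairing d - (w.2 d.1 + d.2 w.1) + pairing w := by
    simp only [pairing, Prod.fst_sub, Prod.snd_sub, map_sub, sub_apply]
    ring
  refine ⟨hd.trans (EReal.coe_le_coe_iff.2 ?_), ?_⟩ <;> linarith

/-- Midpoint convexity bounds the distance to almost minimizers. -/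
theorem weight_le_of_almost_min (hconv : IsConvexFun H)
    (hπ : ∀ p, (pairing p : EReal) ≤ H p) {w d v : X × StrongDual ℝ X} {μ ε s t : ℝ} (hμ : 0 < μ)
    (hd : H d ≤ t) (h : t - (w.2 d.1 + d.2 w.1) + pairing w + weight μ (d - w) ≤ ε)
    (hv : H v ≤ s) :
    weight μ (d - w) ≤ 4 * (ε + (s - (w.2 v.1 + v.2 w.1) + pairing w)) +
      6 * weight μ (v - w) := by
  have h1 := (hπ _).trans (hconv.le_combo hd hv (by norm_num : (0 : ℝ) ≤ 1 / 2)
    (by norm_num : (0 : ℝ) ≤ 1 / 2) (by norm_num))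
  rw [EReal.coe_le_coe_iff] at h1
  have h2 := neg_weight_le_pairing hμ ((1 / 2 : ℝ) • ((d - w) + (v - w)))
  rw [weight_half_smul] at h2
  have h3 := weight_add_le hμ (d - w) (v - w)
  have h4 : pairing ((1 / 2 : ℝ) • ((d - w) + (v - w))) =
      pairing ((1 / 2 : ℝ) • d + (1 / 2 : ℝ) • v) -
        (1 / 2) * ((w.2 d.1 + d.2 w.1) + (w.2 v.1 + v.2 w.1)) + pairing w := by
    simp only [pairing, Prod.fst_sub, Prod.snd_sub, map_sub, sub_apply, Prod.smul_fst,
      Prod.smul_snd, Prod.fst_add, Prod.snd_add, map_add, map_smul, add_apply, smul_apply,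
      smul_eq_mul]
    ring
  linarith

end

/-! ### Brøndsted–Rockafellar property and representation of NI operators -/

section

variable {X : Type*} [NormedAddCommGroup X] [NormedSpace ℝ X]
  {H : X × StrongDual ℝ X → EReal}

/-- The strict Brøndsted–Rockafellar property: points with small gap are close to contact points. -/
theorem exists_contact_near [CompleteSpace X] (hconv : IsConvexFun H) (hlsc : LowerSemicontinuous H)
    (hπ : ∀ p, (pairing p : EReal) ≤ H p)
    (hπs : ∀ q, (pairing q : EReal) ≤ pairConjugate H q) {w : X × StrongDual ℝ X} {δ : ℝ}
    (hδ : 0 < δ) (hw : H w ≤ ((pairing w + δ ^ 2 / 64 : ℝ) : EReal)) :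
    ∃ p, H p = (pairing p : EReal) ∧ dist w p ≤ δ := by
  -- Quartering the gap halves the step: the weight of a move is at most `4η(n+1) + 4η(n) = 5η(n)`,
  -- so its squared norm is at most `10η(n) ≤ 16η(n) = (δ/2 · 2⁻ⁿ)²`, and the steps sum to `δ`.
  let η : ℕ → ℝ := fun n => δ ^ 2 / 64 * (1 / 4) ^ n
  have hη : ∀ n, 0 < η n := fun n => by positivity
  have step : ∀ n (v : X × StrongDual ℝ X), H v ≤ ((pairing v + η n : ℝ) : EReal) →
      ∃ d, H d ≤ ((pairing d + η (n + 1) : ℝ) : EReal) ∧ dist v d ≤ δ / 2 * (1 / 2) ^ n := by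
    intro n v hv
    obtain ⟨d, t, hd, ht⟩ := exists_weight_lt hconv hπs v one_pos (hη (n + 1))
    refine ⟨d, (gap_and_weight_le hπ one_pos hd ht.le).1, ?_⟩
    have h1 := weight_le_of_almost_min hconv hπ one_pos hd ht.le hv
    have h2 : weight 1 (d - v) ≤ 5 * η n := by
      have h3 : η (n + 1) = η n / 4 := by simp only [η, pow_succ]; ring
      simp only [sub_self, weight, pairing, Prod.fst_zero, Prod.snd_zero, norm_zero, h3] at h1 ⊢
      linarith
    have h4 : 10 * η n ≤ (δ / 2 * (1 / 2) ^ n) ^ 2 := by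
      have : (δ / 2 * (1 / 2) ^ n) ^ 2 = 16 * η n := by
        simp only [η, mul_pow, ← pow_mul, mul_comm n 2]
        rw [pow_mul]
        norm_num
        ring
      linarith [hη n]
    have h5 : 0 ≤ δ / 2 * (1 / 2) ^ n := by positivity
    simp only [weight, mul_one] at h2
    rw [dist_comm, dist_eq_norm, Prod.norm_def]
    refine max_le (abs_le_of_sq_le_sq' ?_ h5).2 (abs_le_of_sq_le_sq' ?_ h5).2
    · nlinarith [sq_nonneg ‖(d - v).2‖]
    · nlinarith [sq_nonneg ‖(d - v).1‖]
  choose! g hg hgd using step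
  let x : ℕ → X × StrongDual ℝ X := fun n => Nat.rec w g n
  have hx : ∀ n, H (x n) ≤ ((pairing (x n) + η n : ℝ) : EReal) := by
    intro n
    induction n with
    | zero => simpa [x, η] using hw
    | succ n ih => exact hg n _ ih
  have hxd : ∀ n, dist (x n) (x (n + 1)) ≤ δ / 2 * (1 / 2) ^ n := fun n => hgd n _ (hx n)
  obtain ⟨p, hp⟩ := cauchySeq_tendsto_of_complete
    (cauchySeq_of_le_geometric (1 / 2) (δ / 2) (by norm_num) hxd)
  refine ⟨p, le_antisymm ?_ (hπ p), ?_⟩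
  · have hη0 : Tendsto η atTop (𝓝 0) := by
      have := (tendsto_pow_atTop_nhds_zero_of_lt_one (by norm_num : (0 : ℝ) ≤ 1 / 4)
        (by norm_num)).const_mul (δ ^ 2 / 64)
      rwa [mul_zero] at this
    have h1 : Tendsto (fun n => pairing (x n) + η n) atTop (𝓝 (pairing p + 0)) :=
      ((continuous_pairing.tendsto p).comp hp).add hη0
    rw [add_zero] at h1
    exact (lowerSemicontinuous_iff_isClosed_epigraph.1 hlsc).mem_of_tendsto
      (hp.prodMk_nhds ((continuous_coe_real_ereal.tendsto _).comp h1)) (Eventually.of_forall hx)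
  · have := dist_le_of_le_geometric_of_tendsto₀ (1 / 2) (δ / 2) (by norm_num) hxd hp
    have h2 : δ / 2 / (1 - 1 / 2) = δ := by ring
    rw [h2] at this
    exact this

/-- The translated weighted infimum is attained up to `ε` on the contact set. -/
theorem exists_contact_weight_le [CompleteSpace X] (hconv : IsConvexFun H)
    (hlsc : LowerSemicontinuous H) (hπ : ∀ p, (pairing p : EReal) ≤ H p)
    (hπs : ∀ q, (pairing q : EReal) ≤ pairConjugate H q) (w : X × StrongDual ℝ X) {μ ε : ℝ}
    (hμ : 0 < μ) (hε : 0 < ε) :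
    ∃ p, H p = (pairing p : EReal) ∧ pairing (p - w) + weight μ (p - w) ≤ ε := by
  obtain ⟨v, s, hv⟩ := exists_le_coe_of_pairing_le_pairConjugate hπs
  -- This bounds the weight of every almost minimizer with tolerance at most one. Thus `R` is fixed
  -- before `δ`, and `C` controls the variation of `π` and the weight under a move of size at most
  -- `δ ≤ 1`.
  set R₀ : ℝ := 4 * (1 + (s - (w.2 v.1 + v.2 w.1) + pairing w)) + 6 * weight μ (v - w) with hR₀
  set R : ℝ := 1 + |R₀| * (2 / μ) + |R₀| * (2 * μ) with hR
  have hR1 : 1 ≤ R := by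
    have : 0 ≤ |R₀| * (2 / μ) := by positivity
    have : 0 ≤ |R₀| * (2 * μ) := by positivity
    linarith
  have hW : 0 < 1 + μ / 2 + (2 * μ)⁻¹ := by positivity
  set C : ℝ := (2 * R + 1) * (1 + μ / 2 + (2 * μ)⁻¹) with hC
  have hCpos : 0 < C := by positivity
  set δ : ℝ := min 1 (ε / 2 / C) with hδdef
  have hδ : 0 < δ := by positivity
  have hδ1 : δ ≤ 1 := min_le_left _ _
  have hδC : C * δ ≤ ε / 2 := by
    have : δ ≤ ε / 2 / C := min_le_right _ _
    rwa [le_div_iff₀' hCpos] at this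
  obtain ⟨d, t, hd, ht⟩ := exists_weight_lt hconv hπs w hμ
    (by positivity : 0 < min 1 (min (ε / 2) (δ ^ 2 / 64)))
  have hgap := gap_and_weight_le hπ hμ hd
    (ht.le.trans ((min_le_right _ _).trans (min_le_right _ _)))
  have hwt := gap_and_weight_le hπ hμ hd
    (ht.le.trans ((min_le_right _ _).trans (min_le_left _ _)))
  have hbd := weight_le_of_almost_min hconv hπ hμ hd (ht.le.trans (min_le_left _ _)) hv
  obtain ⟨p, hp, hdp⟩ := exists_contact_near hconv hlsc hπ hπs hδ hgap.1
  refine ⟨p, hp, ?_⟩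
  set e := d - w with he
  set f := p - d with hf
  have hpe : p - w = e + f := by rw [he, hf]; abel
  rw [dist_comm, dist_eq_norm, Prod.norm_def, ← hf] at hdp
  have hf1 : ‖f.1‖ ≤ δ := (le_max_left _ _).trans hdp
  have hf2 : ‖f.2‖ ≤ δ := (le_max_right _ _).trans hdp
  have hbd' : weight μ e ≤ |R₀| := hbd.trans (le_abs_self _)
  have hle : ∀ a : ℝ, 0 ≤ a → a ^ 2 ≤ R - 1 → a ≤ R := fun a _ h => by
    nlinarith [sq_nonneg (a - 1)]
  have he1 : ‖e.1‖ ≤ R := by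
    refine hle _ (norm_nonneg _) ?_
    have h1 : μ / 2 * ‖e.1‖ ^ 2 ≤ |R₀| := by
      have : 0 ≤ (2 * μ)⁻¹ * ‖e.2‖ ^ 2 := by positivity
      unfold weight at hbd'
      linarith
    have h2 : ‖e.1‖ ^ 2 ≤ |R₀| * (2 / μ) := by
      calc ‖e.1‖ ^ 2 = μ / 2 * ‖e.1‖ ^ 2 * (2 / μ) := by field_simp
        _ ≤ _ := by gcongr
    have : 0 ≤ |R₀| * (2 * μ) := by positivity
    linarith
  have he2 : ‖e.2‖ ≤ R := by
    refine hle _ (norm_nonneg _) ?_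
    have h1 : (2 * μ)⁻¹ * ‖e.2‖ ^ 2 ≤ |R₀| := by
      have : 0 ≤ μ / 2 * ‖e.1‖ ^ 2 := by positivity
      unfold weight at hbd'
      linarith
    have h2 : ‖e.2‖ ^ 2 ≤ |R₀| * (2 * μ) := by
      calc ‖e.2‖ ^ 2 = (2 * μ)⁻¹ * ‖e.2‖ ^ 2 * (2 * μ) := by field_simp
        _ ≤ _ := by gcongr
    have : 0 ≤ |R₀| * (2 / μ) := by positivity
    linarith
  have hpair : pairing (e + f) ≤ pairing e + (2 * R + 1) * δ := by
    have h1 : pairing (e + f) = pairing e + e.2 f.1 + f.2 e.1 + f.2 f.1 := by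
      simp only [pairing, Prod.fst_add, Prod.snd_add, map_add, add_apply]
      ring
    have hop : ∀ (a : StrongDual ℝ X) (x : X) (A B : ℝ), ‖a‖ ≤ A → ‖x‖ ≤ B → a x ≤ A * B :=
      fun a x A B hA hB => (le_abs_self _).trans ((a.le_opNorm x).trans
        (mul_le_mul hA hB (norm_nonneg _) ((norm_nonneg _).trans hA)))
    have h2 := hop _ _ _ _ he2 hf1
    have h3 := hop _ _ _ _ hf2 he1
    have h4 := hop _ _ _ _ hf2 (hf1.trans hδ1)
    linarith
  have hsq : ∀ {E : Type _} [NormedAddCommGroup E] (a b : E), ‖a‖ ≤ R → ‖b‖ ≤ δ →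
      ‖a + b‖ ^ 2 ≤ ‖a‖ ^ 2 + (2 * R + 1) * δ := by
    intro E _ a b ha hb
    have h1 : ‖a + b‖ ^ 2 ≤ (‖a‖ + δ) ^ 2 := by
      gcongr
      exact (norm_add_le a b).trans (by gcongr)
    nlinarith [norm_nonneg a]
  have hwt2 : weight μ (e + f) ≤ weight μ e + (2 * R + 1) * δ * (μ / 2 + (2 * μ)⁻¹) := by
    have h1 := mul_le_mul_of_nonneg_left (hsq e.1 f.1 he1 hf1) (by positivity : 0 ≤ μ / 2)
    have h2 := mul_le_mul_of_nonneg_left (hsq e.2 f.2 he2 hf2) (by positivity : 0 ≤ (2 * μ)⁻¹)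
    unfold weight
    simp only [Prod.fst_add, Prod.snd_add]
    linarith
  have hwt' := hwt.2
  rw [hpe]
  have : C * δ = (2 * R + 1) * δ + (2 * R + 1) * δ * (μ / 2 + (2 * μ)⁻¹) := by rw [hC]; ring
  linarith

/-- Convex lower semicontinuous `H ≥ π` with `H* ≥ π_*` represent maximal monotone operators. -/
theorem isMaximalMonotoneOp_contact [CompleteSpace X] (hconv : IsConvexFun H)
    (hlsc : LowerSemicontinuous H) (hπ : ∀ p, (pairing p : EReal) ≤ H p)
    (hπs : ∀ q, (pairing q : EReal) ≤ pairConjugate H q) :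
    IsMaximalMonotoneOp {p | H p = (pairing p : EReal)} := by
  refine ⟨isMonotoneOp_contact hconv hπ, fun S hS hTS q hq => ?_⟩
  rw [← (isClosed_contact hlsc hπ).closure_eq]
  refine Metric.mem_closure_iff.2 fun δ hδ => ?_
  obtain ⟨p, hp, hpw⟩ := exists_contact_weight_le hconv hlsc hπ hπs q one_pos
    (by positivity : 0 < δ ^ 2 / 4)
  refine ⟨p, hp, ?_⟩
  -- Monotonicity of the larger operator makes `π(p - q)` nonnegative, so the weight alone is small
  -- and `q` is a limit of contact points.
  have h1 : 0 ≤ pairing (p - q) := hS p (hTS hp) q hq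
  simp only [weight, mul_one] at hpw
  rw [dist_comm, dist_eq_norm, Prod.norm_def]
  refine max_lt (abs_lt_of_sq_lt_sq' ?_ hδ.le).2 (abs_lt_of_sq_lt_sq' ?_ hδ.le).2
  · nlinarith [sq_nonneg ‖(p - q).2‖]
  · nlinarith [sq_nonneg ‖(p - q).1‖]

/-- Convex lower semicontinuous `H ≥ π` with `H* ≥ π_*` represent operators of type NI. -/
theorem isTypeNI_contact [CompleteSpace X] (hconv : IsConvexFun H)
    (hlsc : LowerSemicontinuous H) (hπ : ∀ p, (pairing p : EReal) ≤ H p)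
    (hπs : ∀ q, (pairing q : EReal) ≤ pairConjugate H q) :
    IsTypeNI {p | H p = (pairing p : EReal)} := by
  intro xs xss
  by_contra hlt
  obtain ⟨r, hr0, hr⟩ := EReal.lt_iff_exists_real_btwn.1 (not_le.1 hlt)
  have hr0' : 0 < r := EReal.coe_pos.1 hr0
  -- By Young's inequality, replacing the base point `0` by `xss` costs at most `μ‖xss‖²/2 ≤ r/2`
  -- once the weight absorbs `‖p.2 - xs‖²`.
  set μ : ℝ := r / (‖xss‖ ^ 2 + 1) with hμdef
  have hμ : 0 < μ := by positivity
  obtain ⟨p, hp, hpw⟩ := exists_contact_weight_le hconv hlsc hπ hπs (0, xs) hμ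
    (by positivity : 0 < r / 2)
  refine absurd (hr.trans_le (iInf₂_le p hp)) (not_lt.2 ?_)
  rw [EReal.coe_le_coe_iff]
  have h1 : xss (xs - p.2) ≤ ‖xss‖ * ‖p.2 - xs‖ := by
    rw [norm_sub_rev]
    exact (le_abs_self _).trans (xss.le_opNorm _)
  have h2 : ‖xss‖ * ‖p.2 - xs‖ ≤ μ / 2 * ‖xss‖ ^ 2 + (2 * μ)⁻¹ * ‖p.2 - xs‖ ^ 2 := by
    have h3 : μ / 2 * ‖xss‖ ^ 2 + (2 * μ)⁻¹ * ‖p.2 - xs‖ ^ 2 - ‖xss‖ * ‖p.2 - xs‖ =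
        (2 * μ)⁻¹ * (μ * ‖xss‖ - ‖p.2 - xs‖) ^ 2 := by field_simp; ring
    have : 0 ≤ (2 * μ)⁻¹ * (μ * ‖xss‖ - ‖p.2 - xs‖) ^ 2 := by positivity
    linarith
  have h4 : μ * ‖xss‖ ^ 2 ≤ r := by
    have : μ * (‖xss‖ ^ 2 + 1) = r := by rw [hμdef]; field_simp
    linarith
  have h5 : 0 ≤ μ / 2 * ‖p.1‖ ^ 2 := by positivity
  simp only [weight, pairing, Prod.fst_sub, Prod.snd_sub, sub_zero] at hpw
  simp only [sub_apply, map_sub, NormedSpace.dual_def] at h1 hpw ⊢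
  linarith

end

/-! ### Lower semicontinuous closure -/

section

section LscClosure

theorem le_of_forall_coe_le {x y : EReal} (h : ∀ r : ℝ, y ≤ r → x ≤ r) : x ≤ y := by
  induction y with
  | bot =>
    rw [le_bot_iff, EReal.eq_bot_iff_forall_lt]
    intro r
    refine (h (r - 1) bot_le).trans_lt ?_
    rw [EReal.coe_lt_coe_iff]
    linarith
  | top => exact le_top
  | coe y => exact h y le_rfl

variable {E : Type*} [TopologicalSpace E] {f g : E → EReal}

theorem lscClosure_le (x : E) : lscClosure f x ≤ f x := iSup₂_le fun _ hg => hg.2 x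

theorem le_lscClosure (hg : LowerSemicontinuous g) (hgf : ∀ y, g y ≤ f y) (x : E) :
    g x ≤ lscClosure f x :=
  le_iSup₂ (f := fun (g : E → EReal) (_ : g ∈ {g | LowerSemicontinuous g ∧ ∀ y, g y ≤ f y}) => g x)
    g ⟨hg, hgf⟩

theorem lowerSemicontinuous_lscClosure : LowerSemicontinuous (lscClosure f) :=
  lowerSemicontinuous_biSup fun _ hg => hg.1

theorem isClosed_coe_epigraph (hf : LowerSemicontinuous f) :
    IsClosed {p : E × ℝ | f p.1 ≤ (p.2 : EReal)} :=
  (lowerSemicontinuous_iff_isClosed_epigraph.1 hf).preimage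
    (f := fun p : E × ℝ => (p.1, (p.2 : EReal)))
    (continuous_fst.prodMk (continuous_coe_real_ereal.comp continuous_snd))

/-- The real epigraph of the lower semicontinuous closure is the closure of the epigraph. -/
theorem epigraph_lscClosure :
    {p : E × ℝ | lscClosure f p.1 ≤ (p.2 : EReal)} =
      closure {p : E × ℝ | f p.1 ≤ (p.2 : EReal)} := by
  set C := closure {p : E × ℝ | f p.1 ≤ (p.2 : EReal)} with hC
  have hup : ∀ x (s t : ℝ), (x, s) ∈ C → s ≤ t → (x, t) ∈ C := by
    intro x s t hx hst
    have hc : Continuous fun p : E × ℝ => (p.1, p.2 + (t - s)) := by fun_prop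
    have h1 := map_mem_closure hc hx (t := {p : E × ℝ | f p.1 ≤ (p.2 : EReal)})
      (fun p (hp : f p.1 ≤ (p.2 : EReal)) =>
        hp.trans (EReal.coe_le_coe_iff.2 (by linarith : p.2 ≤ p.2 + (t - s))))
    simpa using h1
  have hlim : ∀ x (t : ℝ), (∀ s, t < s → (x, s) ∈ C) → (x, t) ∈ C := by
    intro x t h
    have h1 : Tendsto (fun s : ℝ => (x, s)) (𝓝[>] t) (𝓝 (x, t)) :=
      ((by fun_prop : Continuous fun s : ℝ => (x, s)).tendsto t).mono_left nhdsWithin_le_nhds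
    exact isClosed_closure.mem_of_tendsto h1
      (by filter_upwards [self_mem_nhdsWithin] with s hs using h s hs)
  refine Set.Subset.antisymm ?_ (closure_minimal (fun p hp => (lscClosure_le p.1).trans hp)
    (isClosed_coe_epigraph lowerSemicontinuous_lscClosure))
  -- As `C` is closed and stable upwards, it is the real epigraph of `g`, which is therefore a lower
  -- semicontinuous minorant of `f`.
  let g : E → EReal := fun x => ⨅ (t : ℝ) (_ : (x, t) ∈ C), (t : EReal)
  have hgle : ∀ x (t : ℝ), g x ≤ t ↔ (x, t) ∈ C := by
    intro x t
    refine ⟨fun h => hlim x t fun s hs => ?_, fun h => iInf₂_le t h⟩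
    have h1 : g x < s := h.trans_lt (EReal.coe_lt_coe_iff.2 hs)
    obtain ⟨r, hr⟩ := iInf_lt_iff.1 h1
    obtain ⟨hrC, hrs⟩ := iInf_lt_iff.1 hr
    exact hup x r s hrC (EReal.coe_lt_coe_iff.1 hrs).le
  have hg : LowerSemicontinuous g := lowerSemicontinuous_of_isClosed_sublevel fun r => by
    simp only [hgle]
    exact isClosed_closure.preimage (by fun_prop : Continuous fun x : E => (x, r))
  have hgf : ∀ x, g x ≤ f x := fun x => le_of_forall_coe_le fun r hr =>
    (hgle x r).2 (subset_closure hr)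
  rintro ⟨x, t⟩ hx
  exact (hgle x t).1 ((le_lscClosure hg hgf x).trans hx)

theorem IsConvexFun.lscClosure {E : Type*} [NormedAddCommGroup E] [NormedSpace ℝ E]
    {f : E → EReal} (hf : IsConvexFun f) : IsConvexFun (lscClosure f) := by
  unfold IsConvexFun
  rw [epigraph_lscClosure]
  exact Convex.closure hf

theorem coe_le_lscClosure {a : E → ℝ} (ha : Continuous a) (haf : ∀ y, (a y : EReal) ≤ f y) (x : E) :
    (a x : EReal) ≤ lscClosure f x :=
  le_lscClosure (g := fun x => (a x : EReal))
    (continuous_coe_real_ereal.comp ha).lowerSemicontinuous haf x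

end LscClosure

variable {X : Type*} [NormedAddCommGroup X] [NormedSpace ℝ X]

/-- A function and its closure have the same continuous affine minorants. -/
theorem pairConjugate_lscClosure (h : X × StrongDual ℝ X → EReal) :
    pairConjugate (lscClosure h) = pairConjugate h := by
  funext q
  refine le_antisymm (le_of_forall_coe_le fun r hr => ?_) (le_of_forall_coe_le fun r hr => ?_)
  · rw [pairConjugate_le_coe_iff] at hr ⊢
    have h1 : ∀ z, ((q.1 z.1 + q.2 z.2 - r : ℝ) : EReal) ≤ h z := fun z =>
      coe_le_iff_forall_real.2 (hr z)
    exact fun z => coe_le_iff_forall_real.1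
      (coe_le_lscClosure (a := fun z => q.1 z.1 + q.2 z.2 - r) (by fun_prop) h1 z)
  · rw [pairConjugate_le_coe_iff] at hr ⊢
    exact fun z s hz => hr z s ((lscClosure_le z).trans hz)

theorem transposeConj_lscClosure (h : X × StrongDual ℝ X → EReal) :
    transposeConj (lscClosure h) = transposeConj h := by
  unfold transposeConj
  rw [pairConjugate_lscClosure]

/-! ### Inf-convolution in the dual variable and its conjugate -/

section PartialInfConv

variable {h₁ h₂ : X × StrongDual ℝ X → EReal}

theorem partialInfConv_add_le (x : X) (a b : StrongDual ℝ X) :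
    partialInfConv h₁ h₂ (x, a + b) ≤ h₁ (x, a) + h₂ (x, b) := by
  have h := iInf_le (fun y => h₁ (x, y) + h₂ (x, a + b - y)) a
  rwa [add_sub_cancel_left] at h

theorem partialInfConv_le_coe {x : X} {a b : StrongDual ℝ X} {s t : ℝ} (ha : h₁ (x, a) ≤ s)
    (hb : h₂ (x, b) ≤ t) : partialInfConv h₁ h₂ (x, a + b) ≤ ((s + t : ℝ) : EReal) := by
  rw [EReal.coe_add]
  exact (partialInfConv_add_le x a b).trans (add_le_add ha hb)

theorem pairing_le_partialInfConv (hπ₁ : ∀ p, (pairing p : EReal) ≤ h₁ p)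
    (hπ₂ : ∀ p, (pairing p : EReal) ≤ h₂ p) (p : X × StrongDual ℝ X) :
    (pairing p : EReal) ≤ partialInfConv h₁ h₂ p := by
  refine le_iInf fun y => ?_
  have h1 : pairing p = pairing (p.1, y) + pairing (p.1, p.2 - y) := by
    simp [pairing]
  rw [h1, EReal.coe_add]
  exact add_le_add (hπ₁ _) (hπ₂ _)

/-- Minorization by `π` excludes `⊥`, so a finite bound on the sum forces both terms to be real
despite the convention `⊥ + ⊤ = ⊥`. -/
theorem exists_of_partialInfConv_lt (hπ₁ : ∀ p, (pairing p : EReal) ≤ h₁ p)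
    (hπ₂ : ∀ p, (pairing p : EReal) ≤ h₂ p) {p : X × StrongDual ℝ X} {r : ℝ}
    (h : partialInfConv h₁ h₂ p < r) :
    ∃ a b : StrongDual ℝ X, ∃ s t : ℝ, p.2 = a + b ∧ h₁ (p.1, a) ≤ s ∧ h₂ (p.1, b) ≤ t ∧
      s + t < r := by
  obtain ⟨y, hy⟩ := iInf_lt_iff.1 h
  have e1 : h₁ (p.1, y) ≠ ⊥ := ((EReal.bot_lt_coe _).trans_le (hπ₁ _)).ne'
  have e2 : h₂ (p.1, p.2 - y) ≠ ⊥ := ((EReal.bot_lt_coe _).trans_le (hπ₂ _)).ne'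
  have e3 : h₁ (p.1, y) ≠ ⊤ := fun h0 => by
    rw [h0, EReal.top_add_of_ne_bot e2] at hy
    exact not_top_lt hy
  have e4 : h₂ (p.1, p.2 - y) ≠ ⊤ := fun h0 => by
    rw [h0, EReal.add_top_of_ne_bot e1] at hy
    exact not_top_lt hy
  refine ⟨y, p.2 - y, (h₁ (p.1, y)).toReal, (h₂ (p.1, p.2 - y)).toReal, by abel,
    (EReal.coe_toReal e3 e1).ge, (EReal.coe_toReal e4 e2).ge, ?_⟩
  rw [← EReal.coe_toReal e3 e1, ← EReal.coe_toReal e4 e2, ← EReal.coe_add] at hy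
  exact EReal.coe_lt_coe_iff.1 hy

theorem isConvexFun_partialInfConv (hc₁ : IsConvexFun h₁) (hc₂ : IsConvexFun h₂)
    (hπ₁ : ∀ p, (pairing p : EReal) ≤ h₁ p) (hπ₂ : ∀ p, (pairing p : EReal) ≤ h₂ p) :
    IsConvexFun (partialInfConv h₁ h₂) := by
  rintro ⟨p, s⟩ hp ⟨q, t⟩ hq a b ha hb hab
  change partialInfConv h₁ h₂ (a • p + b • q) ≤ ((a * s + b * t : ℝ) : EReal)
  have hp' : partialInfConv h₁ h₂ p ≤ s := hp
  have hq' : partialInfConv h₁ h₂ q ≤ t := hq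
  refine EReal.le_of_forall_lt_iff_le.1 fun r hr => ?_
  rw [EReal.coe_lt_coe_iff] at hr
  -- The infimum over splittings need not be attained, so both endpoints are split with slack `ε`.
  set ε := r - (a * s + b * t) with hε
  have hε0 : 0 < ε := by linarith
  obtain ⟨p₁, p₂, s₁, s₂, hp12, hs₁, hs₂, hs⟩ := exists_of_partialInfConv_lt hπ₁ hπ₂
    (hp'.trans_lt (EReal.coe_lt_coe_iff.2 (by linarith : s < s + ε)))
  obtain ⟨q₁, q₂, t₁, t₂, hq12, ht₁, ht₂, ht⟩ := exists_of_partialInfConv_lt hπ₁ hπ₂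
    (hq'.trans_lt (EReal.coe_lt_coe_iff.2 (by linarith : t < t + ε)))
  have h1 := hc₁.le_combo hs₁ ht₁ ha hb hab
  have h2 := hc₂.le_combo hs₂ ht₂ ha hb hab
  have h3 := partialInfConv_le_coe h1 h2
  have h4 : (a • p.1 + b • q.1, (a • p₁ + b • q₁) + (a • p₂ + b • q₂)) = a • p + b • q := by
    refine Prod.ext rfl ?_
    simp only [Prod.snd_add, Prod.smul_snd, hp12, hq12, smul_add]
    abel
  have h5 : partialInfConv h₁ h₂ (a • p + b • q) ≤
      ((a * s₁ + b * t₁ + (a * s₂ + b * t₂) : ℝ) : EReal) := by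
    rw [← h4]
    exact h3
  refine h5.trans (EReal.coe_le_coe_iff.2 ?_)
  have h6 := mul_le_mul_of_nonneg_left hs.le ha
  have h7 := mul_le_mul_of_nonneg_left ht.le hb
  have h8 : ε = a * ε + b * ε := by rw [← add_mul, hab, one_mul]
  linarith

/-- Attouch–Brezis duality: under the qualification condition, the conjugate of the partial
inf-convolution is an exact inf-convolution of the conjugates. -/
theorem exists_pairConjugate_split [CompleteSpace X] (hc₁ : IsConvexFun h₁) (hc₂ : IsConvexFun h₂)
    (hl₁ : LowerSemicontinuous h₁) (hl₂ : LowerSemicontinuous h₂) {V : Submodule ℝ X}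
    (hV : IsClosed (V : Set X))
    (hcond : (⋃ c ∈ Set.Ioi (0 : ℝ), c • (domX h₁ - domX h₂)) = (V : Set X))
    {q : StrongDual ℝ X × StrongDual ℝ (StrongDual ℝ X)} {r : ℝ}
    (hr : pairConjugate (partialInfConv h₁ h₂) q ≤ r) :
    ∃ u : StrongDual ℝ X,
      (∀ β : ℝ, (β : EReal) ≤ pairConjugate h₂ (q.1 - u, q.2) →
        pairConjugate h₁ (u, q.2) ≤ ((r - β : ℝ) : EReal)) ∧
      (∀ α : ℝ, (α : EReal) ≤ pairConjugate h₁ (u, q.2) →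
        pairConjugate h₂ (q.1 - u, q.2) ≤ ((r - α : ℝ) : EReal)) := by
  let P := (X × StrongDual ℝ X) × ℝ
  let K : Set (P × P) := {p : P | h₁ p.1 ≤ (p.2 : EReal)} ×ˢ {p : P | h₂ p.1 ≤ (p.2 : EReal)}
  have hK : Convex ℝ K := Convex.prod hc₁ hc₂
  have hKc : IsClosed K := (isClosed_coe_epigraph hl₁).prod (isClosed_coe_epigraph hl₂)
  let pr₁ : P × P →L[ℝ] P := ContinuousLinearMap.fst ℝ P P
  let pr₂ : P × P →L[ℝ] P := ContinuousLinearMap.snd ℝ P P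
  let pt : P →L[ℝ] X × StrongDual ℝ X := ContinuousLinearMap.fst ℝ _ _
  let val : P →L[ℝ] ℝ := ContinuousLinearMap.snd ℝ _ _
  let x : P →L[ℝ] X := (ContinuousLinearMap.fst ℝ _ _).comp pt
  let xs : P →L[ℝ] StrongDual ℝ X := (ContinuousLinearMap.snd ℝ _ _).comp pt
  -- Computing `h*` becomes a linear program over the product of epigraphs, with the equality of the
  -- two `X` components as constraint; the multiplier `u` decouples them.
  let A : P × P →L[ℝ] X := x.comp pr₁ - x.comp pr₂
  let B : StrongDual ℝ (P × P) := val.comp pr₁ + val.comp pr₂ -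
    (q.2.comp (xs.comp pr₁) + q.2.comp (xs.comp pr₂)) - q.1.comp (x.comp pr₂)
  have hA : ∀ e, A e = e.1.1.1 - e.2.1.1 := fun e => rfl
  have hB : ∀ e, B e = e.1.2 + e.2.2 - (q.2 e.1.1.2 + q.2 e.2.1.2) - q.1 e.2.1.1 := fun e => rfl
  rw [pairConjugate_le_coe_iff] at hr
  obtain ⟨u, hu⟩ := exists_multiplier_of_absorbing_submodule hK hKc A B V hV
    (fun e he => by
      have h1 : A e ∈ (V : Set X) := by
        rw [← hcond]
        refine Set.mem_biUnion (x := (1 : ℝ)) (Set.mem_Ioi.2 one_pos) ?_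
        rw [one_smul]
        exact Set.sub_mem_sub ⟨e.1.1.2, lt_of_le_of_lt he.1 (EReal.coe_lt_top _)⟩
          ⟨e.2.1.2, lt_of_le_of_lt he.2 (EReal.coe_lt_top _)⟩
      exact h1)
    (fun v hv => by
      have h1 : v ∈ (V : Set X) := hv
      rw [← hcond] at h1
      obtain ⟨c, hc, hv⟩ := Set.mem_iUnion₂.1 h1
      obtain ⟨_, ⟨z, ⟨zs, hz⟩, z', ⟨zs', hz'⟩, rfl⟩, rfl⟩ := hv
      obtain ⟨s, hs, -⟩ := EReal.lt_iff_exists_real_btwn.1 hz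
      obtain ⟨t, ht, -⟩ := EReal.lt_iff_exists_real_btwn.1 hz'
      exact ⟨c, hc, (((z, zs), s), ((z', zs'), t)), ⟨hs.le, ht.le⟩, rfl⟩)
    (β := -r)
    (fun e he h0 => by
      rw [hA, sub_eq_zero] at h0
      have h1 : h₂ (e.1.1.1, e.2.1.2) ≤ (e.2.2 : EReal) := by
        rw [h0]; exact he.2
      have h2 := hr _ _ (partialInfConv_le_coe (x := e.1.1.1) (a := e.1.1.2) (b := e.2.1.2)
        he.1 h1)
      simp only [map_add] at h2
      rw [hB, ← h0]
      linarith)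
  have key : ∀ p₁ (s₁ : ℝ) p₂ (s₂ : ℝ), h₁ p₁ ≤ s₁ → h₂ p₂ ≤ s₂ →
      u p₁.1 + q.2 p₁.2 - s₁ + ((q.1 - u) p₂.1 + q.2 p₂.2 - s₂) ≤ r := by
    intro p₁ s₁ p₂ s₂ hp₁ hp₂
    have h1 := hu ((p₁, s₁), (p₂, s₂)) ⟨hp₁, hp₂⟩
    rw [hA, hB] at h1
    simp only [map_sub, sub_apply] at h1 ⊢
    linarith
  -- Fixing a point of one epigraph and taking the supremum over the other yields the two
  -- conditional bounds without adding extended reals.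
  refine ⟨u, fun β hβ => pairConjugate_le_coe_iff.2 fun p₁ s₁ hp₁ => ?_,
    fun α hα => pairConjugate_le_coe_iff.2 fun p₂ s₂ hp₂ => ?_⟩
  · have h1 := coe_le_iff_forall_real.1 hβ (r - (u p₁.1 + q.2 p₁.2 - s₁))
      (pairConjugate_le_coe_iff.2 fun p₂ s₂ hp₂ => by
        have := key p₁ s₁ p₂ s₂ hp₁ hp₂
        dsimp only
        linarith)
    dsimp only
    linarith
  · have h1 := coe_le_iff_forall_real.1 hα (r - ((q.1 - u) p₂.1 + q.2 p₂.2 - s₂))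
      (pairConjugate_le_coe_iff.2 fun p₁ s₁ hp₁ => by
        have := key p₁ s₁ p₂ s₂ hp₁ hp₂
        dsimp only
        linarith)
    dsimp only
    linarith

end PartialInfConv

end

end MonotoneNI

/-! ### The sum theorem -/

theorem mainTheorem3 {X : Type*} [NormedAddCommGroup X] [NormedSpace ℝ X] [CompleteSpace X]
    (T₁ T₂ : Set (X × StrongDual ℝ X))
    (hT₁ : IsMaximalMonotoneOp T₁) (hT₁NI : IsTypeNI T₁)
    (hT₂ : IsMaximalMonotoneOp T₂) (hT₂NI : IsTypeNI T₂)
    (h₁ h₂ : X × StrongDual ℝ X → EReal)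
    (hh₁ : h₁ ∈ fitzpatrickFamily T₁) (hh₂ : h₂ ∈ fitzpatrickFamily T₂)
    (h : X × StrongDual ℝ X → EReal) (h_def : h = partialInfConv h₁ h₂)
    (hcond : ∃ V : Submodule ℝ X, IsClosed (V : Set X) ∧
      (⋃ c ∈ Set.Ioi (0 : ℝ), c • (domX h₁ - domX h₂)) = (V : Set X)) :
    (∀ p, (pairing p : EReal) ≤ h p) ∧
    (∀ q, (pairing q : EReal) ≤ pairConjugate h q) ∧
    (∀ p, (pairing p : EReal) ≤ transposeConj h p) ∧
    (∀ q, (pairing q : EReal) ≤ pairConjugate (transposeConj h) q) ∧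
    opSum T₁ T₂ = {p | transposeConj h p = (pairing p : EReal)} ∧
    opSum T₁ T₂ = {p | h p = (pairing p : EReal)} ∧
    IsMaximalMonotoneOp (opSum T₁ T₂) ∧
    IsTypeNI (opSum T₁ T₂) ∧
    transposeConj h ∈ fitzpatrickFamily (opSum T₁ T₂) ∧
    lscClosure h ∈ fitzpatrickFamily (opSum T₁ T₂) := by
  subst h_def
  set h := partialInfConv h₁ h₂ with hdef
  obtain ⟨hc₁, hl₁, hπ₁, he₁⟩ := hh₁
  obtain ⟨hc₂, hl₂, hπ₂, he₂⟩ := hh₂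
  obtain ⟨V, hV, hcond⟩ := hcond
  have hs₁ := pairing_le_pairConjugate_of_isTypeNI hT₁NI he₁
  have hs₂ := pairing_le_pairConjugate_of_isTypeNI hT₂NI he₂
  have hπ : ∀ p, (pairing p : EReal) ≤ h p := pairing_le_partialInfConv hπ₁ hπ₂
  have hconv : IsConvexFun h := isConvexFun_partialInfConv hc₁ hc₂ hπ₁ hπ₂
  have hs : ∀ q, (pairing q : EReal) ≤ pairConjugate h q := fun q => by
    refine coe_le_iff_forall_real.2 fun r hr => ?_
    obtain ⟨u, hu, -⟩ := exists_pairConjugate_split hc₁ hc₂ hl₁ hl₂ hV hcond hr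
    have h1 := EReal.coe_le_coe_iff.1 ((hs₁ (u, q.2)).trans (hu _ (hs₂ (q.1 - u, q.2))))
    simp only [pairing, map_sub] at h1 ⊢
    linarith
  have hJ : ∀ p, (pairing p : EReal) ≤ transposeConj h p := fun p =>
    hs (p.2, NormedSpace.inclusionInDoubleDual ℝ X p.1)
  have hclπ : ∀ p, (pairing p : EReal) ≤ lscClosure h p := coe_le_lscClosure continuous_pairing hπ
  have hcls : ∀ q, (pairing q : EReal) ≤ pairConjugate (lscClosure h) q := by
    rwa [pairConjugate_lscClosure]
  have hcll := lowerSemicontinuous_lscClosure (f := h)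
  -- Maximality and NI are obtained for this set before it is identified with the sum; maximality
  -- then forces `𝒥 h` to have no further contact points.
  set T := {p | lscClosure h p = (pairing p : EReal)} with hT
  have hTmax : IsMaximalMonotoneOp T := isMaximalMonotoneOp_contact hconv.lscClosure hcll hclπ hcls
  have hTNI : IsTypeNI T := isTypeNI_contact hconv.lscClosure hcll hclπ hcls
  have hJT : ∀ p ∈ T, transposeConj h p = (pairing p : EReal) := fun p hp => by
    have := transposeConj_eq_pairing_of_contact hconv.lscClosure hclπ hcls hp
    rwa [transposeConj_lscClosure] at this
  have hJeq : {p | transposeConj h p = (pairing p : EReal)} = T :=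
    contact_eq_of_isMaximalMonotoneOp isConvexFun_transposeConj hJ hTmax hJT
  have hJ₁ : {p | transposeConj h₁ p = (pairing p : EReal)} = T₁ :=
    contact_eq_of_isMaximalMonotoneOp isConvexFun_transposeConj
      (fun p => hs₁ (p.2, NormedSpace.inclusionInDoubleDual ℝ X p.1)) hT₁
      fun p hp => transposeConj_eq_pairing_of_contact hc₁ hπ₁ hs₁ (he₁ p hp)
  have hJ₂ : {p | transposeConj h₂ p = (pairing p : EReal)} = T₂ :=
    contact_eq_of_isMaximalMonotoneOp isConvexFun_transposeConj
      (fun p => hs₂ (p.2, NormedSpace.inclusionInDoubleDual ℝ X p.1)) hT₂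
      fun p hp => transposeConj_eq_pairing_of_contact hc₂ hπ₂ hs₂ (he₂ p hp)
  have hsum_h : opSum T₁ T₂ ⊆ {p | h p = (pairing p : EReal)} := by
    rintro ⟨x, xs⟩ ⟨u, v, hu, hv, huv⟩
    have huv' : xs = u + v := huv
    subst huv'
    refine le_antisymm ((partialInfConv_le_coe (he₁ _ hu).le (he₂ _ hv).le).trans (le_of_eq ?_))
      (hπ _)
    simp [pairing]
  have hh_T : {p | h p = (pairing p : EReal)} ⊆ T := fun p hp =>
    le_antisymm ((lscClosure_le p).trans (le_of_eq hp)) (hclπ p)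
  have hT_sum : T ⊆ opSum T₁ T₂ := by
    rintro ⟨x, xs⟩ hp
    -- The two conjugates at the split point are at least `⟨x, u⟩` and `⟨x, xs - u⟩`, whose sum is
    -- `⟨x, xs⟩`, so both are equalities.
    obtain ⟨u, hu, hu'⟩ := exists_pairConjugate_split hc₁ hc₂ hl₁ hl₂ hV hcond (hJT _ hp).le
    have e1 := hu _ (hs₂ _)
    have e2 := hu' _ (hs₁ _)
    refine ⟨u, xs - u, ?_, ?_, by simp⟩
    · rw [← hJ₁]
      refine le_antisymm (e1.trans (le_of_eq ?_)) (hs₁ (u, NormedSpace.inclusionInDoubleDual ℝ X x))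
      simp [pairing]
    · rw [← hJ₂]
      refine le_antisymm (e2.trans (le_of_eq ?_))
        (hs₂ (xs - u, NormedSpace.inclusionInDoubleDual ℝ X x))
      simp [pairing]
  have hsumT : opSum T₁ T₂ = T := (hsum_h.trans hh_T).antisymm hT_sum
  have hhT : {p | h p = (pairing p : EReal)} = T :=
    hh_T.antisymm (hT_sum.trans hsum_h)
  rw [hsumT]
  exact ⟨hπ, hs, hJ, pairing_le_pairConjugate_of_isTypeNI hTNI hJT, hJeq.symm, hhT.symm, hTmax,
    hTNI, ⟨isConvexFun_transposeConj, lowerSemicontinuous_transposeConj, hJ, hJT⟩,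
    hconv.lscClosure, hcll, hclπ, fun _ hp => hp⟩
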